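/- Let $K$ be a field, let $S=K[x,y]$, and let $I\subset S$ be an ideal generated by monomials such that $R=S/I$ is Cohen–Macaulay. Let $m=\mu(I)\ge 1$ be the minimal number of generators of $I$, and let $X$ be a Hilbert–Burch matrix of $I$, that is, an $m\times(m-1)$ matrix with entries in $S$ which represents, with respect to some bases, the map $\varphi$ in a free resolution $$0\longrightarrow S^{m-1}\overset{\varphi}{\longrightarrow}S^m\longrightarrow I\longrightarrow 0.$$ For $j\in\mathbb{Z}$ let $I_j(X)\subseteq S$ be the ideal generated by the $j$-minors of $X$, where $I_j(X)=S$ if $j\le 0$. Let $\omega_R=\mathrm{Ext}^{c}_S(R,S)$, $c=\mathrm{height}\, I$, be the canonical module of $R$, and let $$\mathrm{tr}(\omega_R)=\sum_{f\in\mathrm{Hom}_R(\omega_R,R)}f(\omega_R)\subseteq R$$ be its trace ideal. Then $I\subseteq I_{m-2}(X)$ and $$\mathrm{tr}(\omega_R)=I_{m-2}(X)/I=I_{m-2}(X)R.$$ That is, Herzog's conjecture, which predicts that $\mathrm{tr}(\omega_R)=I_{\mu(I)-2}(X)R$, holds for this class of ideals. -/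

import Mathlib

universe u

noncomputable section

namespace CanonicalTrace

open CategoryTheory

/-- An ideal of a polynomial ring is a monomial ideal if it is generated by a set of monomials. -/
def IsMonomialIdeal {σ : Type*} {K : Type*} [Field K] (I : Ideal (MvPolynomial σ K)) : Prop :=
  ∃ A : Set (σ →₀ ℕ), I = Ideal.span ((fun s => MvPolynomial.monomial s (1 : K)) '' A)

/-- A Noetherian local ring is Cohen-Macaulay if its depth equals its Krull dimension. As the depth
is the maximal length of a regular sequence and never exceeds the dimension, this says that some
regular sequence has length equal to the dimension. (The elements of a regular sequence `rs` are
automatically in the maximal ideal, since `IsRegular` contains `(rs) ≠ A`.) -/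
def IsCohenMacaulayLocal (A : Type*) [CommRing A] [IsLocalRing A] : Prop :=
  IsNoetherianRing A ∧
    ∃ rs : List A, RingTheory.Sequence.IsRegular A rs ∧
      ((rs.length : ℕ) : WithBot ℕ∞) = ringKrullDim A

/-- A ring is Cohen-Macaulay if it is Noetherian and all its localizations at maximal ideals are
Cohen-Macaulay local rings. -/
def IsCohenMacaulay (R : Type*) [CommRing R] : Prop :=
  IsNoetherianRing R ∧
    ∀ (p : Ideal R) [p.IsMaximal], IsCohenMacaulayLocal (Localization.AtPrime p)

section CanonicalModule

variable {S : Type u} [CommRing S] (I : Ideal S)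

/-- The canonical module `ω_R = Ext^c_S(S/I, S)`, `c = height I`, of a Cohen-Macaulay quotient
`R = S/I` of a polynomial ring `S` over a field (the degree shift of the graded version plays no
role for the trace). -/
def CanonicalModule : Type u :=
  Abelian.Ext (ModuleCat.of S (S ⧸ I)) (ModuleCat.of S S) I.height.toNat

instance : AddCommGroup (CanonicalModule I) :=
  inferInstanceAs (AddCommGroup
    (Abelian.Ext (ModuleCat.of S (S ⧸ I)) (ModuleCat.of S S) I.height.toNat))

instance : Module S (CanonicalModule I) :=
  inferInstanceAs (Module S
    (Abelian.Ext (ModuleCat.of S (S ⧸ I)) (ModuleCat.of S S) I.height.toNat))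

theorem CanonicalModule.isTorsionBySet :
    Module.IsTorsionBySet S (CanonicalModule I) (I : Set S) := by
  rintro e ⟨a, ha⟩
  let e' : Abelian.Ext (ModuleCat.of S (S ⧸ I)) (ModuleCat.of S S) I.height.toNat := e
  have h0 : a • 𝟙 (ModuleCat.of S (S ⧸ I)) = 0 := by
    ext
    change a • (Ideal.Quotient.mk I 1 : S ⧸ I) = 0
    rw [← Ideal.Quotient.mk_eq_mk, ← Submodule.Quotient.mk_smul]
    exact (Submodule.Quotient.mk_eq_zero I).2 (by simpa using ha)
  have h1 : a • e' = (Abelian.Ext.mk₀ (a • 𝟙 (ModuleCat.of S (S ⧸ I)))).comp e' (zero_add _) := by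
    rw [Abelian.Ext.mk₀_smul, Abelian.Ext.smul_comp, Abelian.Ext.mk₀_id_comp]
  change a • e' = 0
  rw [h1, h0, Abelian.Ext.mk₀_zero, Abelian.Ext.zero_comp]

/-- The `S/I`-module structure of `Ext^c_S(S/I, S)` induced by its `S`-module structure. -/
instance : Module (S ⧸ I) (CanonicalModule I) :=
  (CanonicalModule.isTorsionBySet I).module

end CanonicalModule

/-- The trace ideal `tr(M) = ∑ φ(M)`, the sum over all `φ ∈ Hom_R(M, R)`. -/
def traceIdeal (R : Type*) [CommRing R] (M : Type*) [AddCommGroup M] [Module R M] : Ideal R :=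
  ⨆ φ : M →ₗ[R] R, LinearMap.range φ

/-- The ideal `I_j(X)` generated by the `j`-minors of `X`, with `I_j(X) = S` for `j ≤ 0`. -/
def minorsIdeal {S : Type*} [CommRing S] {m n : Type*} (X : Matrix m n S) (j : ℤ) : Ideal S :=
  if j ≤ 0 then ⊤
  else Ideal.span {d | ∃ (r : Fin j.toNat ↪ m) (c : Fin j.toNat ↪ n), d = (X.submatrix r c).det}

/-- `X` is a Hilbert-Burch matrix of `I`: with `m = n + 1 = μ(I)` the minimal number of generators,
`X` is the matrix, with respect to some bases, of the map `φ` in a free resolution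
`0 → S^(m-1) → S^m → I → 0`. -/
structure IsHilbertBurchMatrix {S : Type*} [CommRing S] (I : Ideal S) {n : ℕ}
    (X : Matrix (Fin (n + 1)) (Fin n) S) : Prop where
  minimal : Submodule.spanFinrank I = n + 1
  injective : Function.Injective X.mulVecLin
  exact : ∃ ε : (Fin (n + 1) → S) →ₗ[S] I,
    Function.Surjective ε ∧ Function.Exact X.mulVecLin ε

end CanonicalTrace

end

open CanonicalTrace

/-!
If `S/I` has a free resolution of length two whose last map is the matrix `X`, then its canonical
module is the cokernel of `Xᵀ`. A homomorphism from it to `S/I` is therefore a vector `v` with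
`X v ≡ 0` modulo `I`, and the trace is the image of the ideal of all coordinates of such vectors,
`kernelCoordIdeal I X` (`traceIdeal_eq_map_kernelCoordIdeal`). In particular this ideal depends only
on `I`, up to the addition of `I` itself, so it may be computed with any resolution.

A nonzero monomial ideal in two variables is generated by monomials `x ^ a i * y ^ b i` with `a`
decreasing and `b` increasing for `i ≤ N`. If `N ≥ 1`, a corner of this staircase gives a socle
element of the quotient, so Cohen-Macaulayness forces dimension zero: the staircase reaches both
axes (`IsStaircase.ends_eq_zero`), and `I` has height two. If `N = 0`, then `I` is principal and the
trace is the unit ideal.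

The syzygies of a staircase form a bidiagonal matrix `X₀` (`staircase_exact`). Comparing
coefficients of a vector killed by `X₀` modulo `I`, one multidegree at a time, shows that its
coordinates are combinations of monomials that are submaximal minors of `X₀`
(`kernelCoordIdeal_staircaseMatrix_le`). Conversely, for every Hilbert-Burch matrix `X`, Cramer's
rule turns the submaximal minors of `X` into coordinates of such vectors
(`minorsIdeal_le_kernelCoordIdeal`).

It remains to see that the submaximal minors of `X₀` lie in the ideal of those of an arbitrary `X`.
Comparing resolutions gives `A * X * B = X₀ * (1 + H * X₀)`. The determinant of `1 + H * X₀` has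
constant term one, as the entries of `X₀` have none. The maximal minors of `X`, hence also the
submaximal ones, generate an ideal containing powers of `x` and `y` (`pow_mem_minorsIdeal`), and
modulo such an ideal this determinant is a unit. The argument avoids gradings and localization,
although `X` need be neither homogeneous nor equivalent to `X₀`.
-/

/-! ### Presentations of the canonical module and its trace -/

open CategoryTheory in
/-- Applying `Hom(-, Y)` to a short exact sequence `0 → P₁ → P₀ → M → 0` with `P₀` projective
presents `Ext¹(M, Y)` as a quotient of `Hom(P₁, Y)`. -/
theorem exists_ext_one_presentation {S : Type u} [CommRing S] {T : ShortComplex (ModuleCat.{u} S)}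
    (hT : T.ShortExact) [Projective T.X₂] (Y : ModuleCat.{u} S) :
    ∃ π : (T.X₁ ⟶ Y) →ₗ[S] Abelian.Ext T.X₃ Y 1, Function.Surjective π ∧
      ∀ g, π g = 0 ↔ ∃ h : T.X₂ ⟶ Y, T.f ≫ h = g := by
  refine ⟨{ toFun := fun g => hT.extClass.comp (Abelian.Ext.mk₀ g) (add_zero 1)
            map_add' := fun g h => by
              rw [Abelian.Ext.mk₀_add, Abelian.Ext.comp_add]
            map_smul' := fun r g => by
              rw [Abelian.Ext.mk₀_smul, Abelian.Ext.comp_smul]; rfl }, ?_, ?_⟩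
  · intro x
    obtain ⟨y, hy⟩ := Abelian.Ext.contravariant_sequence_exact₃ hT Y x
      (Abelian.Ext.eq_zero_of_projective _) (add_zero 1)
    obtain ⟨g, rfl⟩ := Abelian.Ext.addEquiv₀.symm.surjective y
    exact ⟨g, hy⟩
  · intro g
    constructor
    · intro hg
      obtain ⟨y, hy⟩ := Abelian.Ext.contravariant_sequence_exact₁ hT Y (Abelian.Ext.mk₀ g)
        (add_zero 1) hg
      obtain ⟨h, rfl⟩ := Abelian.Ext.addEquiv₀.symm.surjective y
      refine ⟨h, ?_⟩
      have : Abelian.Ext.mk₀ (T.f ≫ h) = Abelian.Ext.mk₀ g := by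
        rw [← hy, ← Abelian.Ext.mk₀_comp_mk₀]; rfl
      exact Abelian.Ext.addEquiv₀.symm.injective this
    · rintro ⟨h, rfl⟩
      change hT.extClass.comp (Abelian.Ext.mk₀ (T.f ≫ h)) (add_zero 1) = 0
      rw [← Abelian.Ext.mk₀_comp_mk₀, hT.extClass_comp_assoc]

open CategoryTheory in
/-- Dimension shifting: for `0 → I → P → M → 0` with `P` projective, `Ext¹(I, Y) ≃ Ext²(M, Y)`. -/
theorem exists_ext_two_equiv {S : Type u} [CommRing S] {T : ShortComplex (ModuleCat.{u} S)}
    (hT : T.ShortExact) [Projective T.X₂] (Y : ModuleCat.{u} S) :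
    Nonempty (Abelian.Ext T.X₁ Y 1 ≃ₗ[S] Abelian.Ext T.X₃ Y 2) := by
  let f : Abelian.Ext T.X₁ Y 1 →ₗ[S] Abelian.Ext T.X₃ Y 2 :=
    { toFun := fun g => hT.extClass.comp g rfl
      map_add' := fun g h => by rw [Abelian.Ext.comp_add]
      map_smul' := fun r g => by rw [Abelian.Ext.comp_smul]; rfl }
  refine ⟨LinearEquiv.ofBijective f ⟨?_, ?_⟩⟩
  · rw [injective_iff_map_eq_zero]
    intro x hx
    obtain ⟨y, rfl⟩ := Abelian.Ext.contravariant_sequence_exact₁ hT Y x rfl hx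
    rw [Abelian.Ext.eq_zero_of_projective y, Abelian.Ext.comp_zero]
  · intro x
    exact Abelian.Ext.contravariant_sequence_exact₃ hT Y x
      (Abelian.Ext.eq_zero_of_projective _) rfl

section Presentation

variable {S : Type u} [CommRing S]

theorem ModuleCat.shortExact_of_exact {A B C : Type u} [AddCommGroup A] [AddCommGroup B]
    [AddCommGroup C] [Module S A] [Module S B] [Module S C] {f : A →ₗ[S] B} {g : B →ₗ[S] C}
    (hf : Function.Injective f) (hfg : Function.Exact f g) (hg : Function.Surjective g) :
    (CategoryTheory.ShortComplex.mk (ModuleCat.ofHom f) (ModuleCat.ofHom g)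
      (by ext x; exact hfg.apply_apply_eq_zero x)).ShortExact where
  exact := (CategoryTheory.ShortComplex.ShortExact.moduleCat_exact_iff_function_exact _).2 hfg
  mono_f := (ModuleCat.mono_iff_injective _).2 hf
  epi_g := (ModuleCat.epi_iff_surjective _).2 hg

/-- The module `M` is presented by the transpose of `X`: it is the cokernel of `Xᵀ`. -/
def IsCokernelTranspose {m n : Type*} [Fintype m] [Fintype n] (X : Matrix m n S) (M : Type*)
    [AddCommGroup M] [Module S M] : Prop :=
  ∃ π : (n → S) →ₗ[S] M, Function.Surjective π ∧ ∀ w, π w = 0 ↔ ∃ v, X.transpose.mulVec v = w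

/-- If `0 → Sⁿ → Sᵐ → M → 0` is exact, with first map given by `X`, then `Ext¹(M, S)` is the
cokernel of the transpose of `X`. -/
theorem isCokernelTranspose_ext_one {m n : Type} [Fintype m] [Fintype n] [DecidableEq m]
    [DecidableEq n] (X : Matrix m n S) {M : Type u} [AddCommGroup M] [Module S M]
    (hX : Function.Injective X.mulVecLin) (ε : (m → S) →ₗ[S] M) (hε : Function.Surjective ε)
    (hXε : Function.Exact X.mulVecLin ε) :
    IsCokernelTranspose X (CategoryTheory.Abelian.Ext (ModuleCat.of S M) (ModuleCat.of S S) 1) := by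
  have hT := ModuleCat.shortExact_of_exact hX hXε hε
  have : CategoryTheory.Projective (ModuleCat.of S (m → S)) :=
    (IsProjective.iff_projective _).1 inferInstance
  obtain ⟨π, hπ, hker⟩ := exists_ext_one_presentation hT (ModuleCat.of S S)
  let e : (n → S) ≃ₗ[S] (ModuleCat.of S (n → S) ⟶ ModuleCat.of S S) :=
    (dotProductEquiv S n).trans (ModuleCat.homLinearEquiv (S := S) (M := ModuleCat.of S (n → S))
      (N := ModuleCat.of S S)).symm
  refine ⟨π ∘ₗ e.toLinearMap, hπ.comp e.surjective, fun w => ?_⟩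
  have he (v : m → S) (g : ModuleCat.of S (m → S) ⟶ ModuleCat.of S S)
      (hg : g.hom = dotProductEquiv S m v) :
      CategoryTheory.CategoryStruct.comp (ModuleCat.ofHom X.mulVecLin) g
        = e (X.transpose.mulVec v) := by
    apply ModuleCat.hom_ext
    refine LinearMap.ext fun x => ?_
    change g.hom (X.mulVec x) = X.transpose.mulVec v ⬝ᵥ x
    rw [hg, Matrix.mulVec_transpose, ← Matrix.dotProduct_mulVec]
    rfl
  refine (hker (e w)).trans ⟨?_, ?_⟩
  · rintro ⟨h, hh⟩
    exact ⟨(dotProductEquiv S m).symm h.hom, e.injective <|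
      (he _ h (by rw [LinearEquiv.apply_symm_apply])).symm.trans hh⟩
  · rintro ⟨v, rfl⟩
    exact ⟨ModuleCat.ofHom (dotProductEquiv S m v), he v _ rfl⟩

theorem IsCokernelTranspose.congr {m n : Type*} [Fintype m] [Fintype n] {X : Matrix m n S}
    {M N : Type*} [AddCommGroup M] [Module S M] [AddCommGroup N] [Module S N]
    (h : IsCokernelTranspose X M) (e : M ≃ₗ[S] N) : IsCokernelTranspose X N := by
  obtain ⟨π, hπ, hker⟩ := h
  exact ⟨e.toLinearMap ∘ₗ π, e.surjective.comp hπ, fun w => by simp [hker]⟩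

theorem ModuleCat.shortExact_ideal (I : Ideal S) :
    (CategoryTheory.ShortComplex.mk (ModuleCat.ofHom (Submodule.subtype I))
      (ModuleCat.ofHom (Submodule.mkQ I))
      (by ext x; exact Ideal.Quotient.eq_zero_iff_mem.2 x.2)).ShortExact :=
  ModuleCat.shortExact_of_exact (Submodule.subtype_injective I)
    (LinearMap.exact_subtype_mkQ I) (Submodule.mkQ_surjective I)

/-- For an ideal of height two with a free resolution of length one given by `X`, the canonical
module of the quotient is the cokernel of the transpose of `X`. -/
theorem isCokernelTranspose_canonicalModule_of_height_eq_two {m n : Type} [Fintype m] [Fintype n]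
    [DecidableEq m] [DecidableEq n] {I : Ideal S} (hI : I.height = 2) {X : Matrix m n S}
    (hX : Function.Injective X.mulVecLin) {ε : (m → S) →ₗ[S] I} (hε : Function.Surjective ε)
    (hXε : Function.Exact X.mulVecLin ε) :
    IsCokernelTranspose X (CanonicalModule I) := by
  have : CategoryTheory.Projective (ModuleCat.of S S) :=
    (IsProjective.iff_projective _).1 inferInstance
  have h1 := isCokernelTranspose_ext_one X hX ε hε hXε
  obtain ⟨e⟩ := exists_ext_two_equiv (ModuleCat.shortExact_ideal I) (ModuleCat.of S S)
  have h2 : IsCokernelTranspose X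
      (CategoryTheory.Abelian.Ext (ModuleCat.of S (S ⧸ I)) (ModuleCat.of S S) 2) := h1.congr e
  have h3 : I.height.toNat = 2 := by rw [hI]; rfl
  rw [← h3] at h2
  exact h2

/-- For a principal ideal of height one, generated by a regular element `f`, the canonical module
of the quotient is `S / (f)`. -/
theorem isCokernelTranspose_canonicalModule_of_height_eq_one {f : S} (hf : f ∈ nonZeroDivisors S)
    (hI : (Ideal.span {f}).height = 1) :
    IsCokernelTranspose (Matrix.of fun _ _ : Unit => f) (CanonicalModule (Ideal.span {f})) := by
  have hmul (v : Unit → S) (i : Unit) : (Matrix.of fun _ _ : Unit => f).mulVecLin v i = f * v i := by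
    simp [Matrix.mulVec, dotProduct]
  have h2 := isCokernelTranspose_ext_one (Matrix.of fun _ _ : Unit => f) (M := S ⧸ Ideal.span {f})
    (fun v w hvw => funext fun i => by
      have := congrFun hvw i
      rw [hmul, hmul] at this
      exact (mul_cancel_left_mem_nonZeroDivisors hf).1 this)
    ((Submodule.mkQ (Ideal.span {f})) ∘ₗ LinearMap.proj ())
    ((Submodule.mkQ_surjective _).comp fun x => ⟨fun _ => x, rfl⟩)
    (fun v => by
      rw [LinearMap.comp_apply, Submodule.mkQ_apply, Submodule.Quotient.mk_eq_zero,
        Ideal.mem_span_singleton]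
      constructor
      · rintro ⟨c, hc⟩
        exact ⟨fun _ => c, funext fun i => (hmul _ i).trans hc.symm⟩
      · rintro ⟨w, rfl⟩
        exact ⟨w (), hmul w ()⟩)
  have h3 : (Ideal.span {f}).height.toNat = 1 := by rw [hI]; rfl
  rw [← h3] at h2
  exact h2

/-- The ideal generated by the coordinates of all vectors `v` such that `X v` vanishes modulo `I`.
Such vectors are the homomorphisms to `S / I` from the cokernel of the transpose of `X`. -/
def kernelCoordIdeal {m n : Type*} [Fintype n] (I : Ideal S) (X : Matrix m n S) : Ideal S :=
  Ideal.span {c | ∃ v : n → S, (∀ i, X.mulVec v i ∈ I) ∧ ∃ j, v j = c}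

theorem mem_kernelCoordIdeal {m n : Type*} [Fintype n] {I : Ideal S} {X : Matrix m n S}
    {v : n → S} (hv : ∀ i, X.mulVec v i ∈ I) (j : n) : v j ∈ kernelCoordIdeal I X :=
  Ideal.subset_span ⟨v, hv, j, rfl⟩

theorem le_kernelCoordIdeal {m n : Type*} [Fintype n] [DecidableEq n] [Nonempty n] (I : Ideal S)
    (X : Matrix m n S) : I ≤ kernelCoordIdeal I X := by
  intro a ha
  let j : n := Classical.arbitrary n
  have := mem_kernelCoordIdeal (I := I) (X := X) (v := Pi.single j a)
    (fun i => by simpa using I.mul_mem_left _ ha) j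
  simpa using this

/-- The trace ideal of a module presented by the transpose of `X`: a homomorphism to `S / I` is
determined by the images of the generators, which form a vector annihilated by `X`. -/
theorem traceIdeal_eq_map_kernelCoordIdeal {m n : Type*} [Fintype m] [Fintype n] [DecidableEq m]
    [DecidableEq n] {I : Ideal S} {X : Matrix m n S}
    (h : IsCokernelTranspose X (CanonicalModule I)) :
    traceIdeal (S ⧸ I) (CanonicalModule I) =
      (kernelCoordIdeal I X).map (Ideal.Quotient.mk I) := by
  obtain ⟨π, hπ, hker⟩ := h
  have : IsScalarTower S (S ⧸ I) (CanonicalModule I) :=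
    (CanonicalModule.isTorsionBySet I).isScalarTower
  apply le_antisymm
  · refine iSup_le fun φ => ?_
    choose v hv using fun j => Ideal.Quotient.mk_surjective (φ (π (Pi.single j 1)))
    have hφ (w : n → S) : φ (π w) = Ideal.Quotient.mk I (v ⬝ᵥ w) := by
      have h1 : w = ∑ j, w j • Pi.single j (1 : S) := by
        ext i; simp [Finset.sum_apply, Pi.single_apply]
      conv_lhs => rw [h1]
      rw [map_sum, map_sum, dotProduct, map_sum]
      refine Finset.sum_congr rfl fun j _ => ?_
      rw [map_smul, LinearMap.map_smul_of_tower, ← hv, mul_comm, map_mul]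
      rfl
    have hXv (i : m) : X.mulVec v i ∈ I := by
      rw [← Ideal.Quotient.eq_zero_iff_mem]
      have h1 : v ⬝ᵥ X.transpose.mulVec (Pi.single i 1) = X.mulVec v i := by
        rw [Matrix.mulVec_transpose, dotProduct_comm, ← Matrix.dotProduct_mulVec]
        simp
      rw [← h1, ← hφ, (hker _).2 ⟨_, rfl⟩, map_zero]
    rintro _ ⟨z, rfl⟩
    obtain ⟨w, rfl⟩ := hπ z
    rw [hφ]
    refine Ideal.mem_map_of_mem _ (Ideal.sum_mem _ fun j _ => ?_)
    exact Ideal.mul_mem_right _ _ (mem_kernelCoordIdeal hXv j)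
  · rw [kernelCoordIdeal, Ideal.map_span, Ideal.span_le]
    rintro _ ⟨_, ⟨v, hv, j, rfl⟩, rfl⟩
    let g : (n → S) →ₗ[S] S ⧸ I := (Submodule.mkQ I) ∘ₗ (dotProductEquiv S n v)
    have hg : LinearMap.ker π ≤ LinearMap.ker g := by
      intro w hw
      obtain ⟨u, rfl⟩ := (hker w).1 hw
      have h1 : v ⬝ᵥ X.transpose.mulVec u = u ⬝ᵥ X.mulVec v := by
        rw [Matrix.mulVec_transpose, dotProduct_comm, ← Matrix.dotProduct_mulVec]
      change Submodule.mkQ I (v ⬝ᵥ X.transpose.mulVec u) = 0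
      rw [h1, Submodule.mkQ_apply, Submodule.Quotient.mk_eq_zero]
      exact Ideal.sum_mem _ fun i _ => I.mul_mem_left _ (hv i)
    let ψ : CanonicalModule I →ₗ[S] S ⧸ I :=
      (LinearMap.ker π).liftQ g hg ∘ₗ (π.quotKerEquivOfSurjective hπ).symm.toLinearMap
    have hψ (w : n → S) : ψ (π w) = Ideal.Quotient.mk I (v ⬝ᵥ w) := by
      have : (π.quotKerEquivOfSurjective hπ).symm (π w) = Submodule.Quotient.mk w := by
        rw [LinearEquiv.symm_apply_eq]; rfl
      change (LinearMap.ker π).liftQ g hg ((π.quotKerEquivOfSurjective hπ).symm (π w)) = _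
      rw [this]; rfl
    refine Submodule.mem_iSup_of_mem
      (ψ.extendScalarsOfSurjective (R := S) (S := S ⧸ I) Ideal.Quotient.mk_surjective)
      ⟨π (Pi.single j 1), ?_⟩
    refine (hψ _).trans ?_
    simp

end Presentation

/-! ### Minors -/

section Minors

variable {S : Type*} [CommRing S]

/-- The determinant of a product `A * B` of an `l × m` and an `m × l` matrix is a linear combination
of maximal minors of `B`. -/
theorem Matrix.det_mul_mem_span_minors {l m : Type*} [Fintype l] [DecidableEq l] [Fintype m]
    (A : Matrix l m S) (B : Matrix m l S) :
    (A * B).det ∈ Ideal.span {d | ∃ r : l ↪ m, d = (B.submatrix r id).det} := by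
  classical
  have h1 : A * B = fun i => ∑ k, A i k • B k := by
    ext i j
    simp [Matrix.mul_apply, Finset.sum_apply]
  have h2 : (A * B).det = ∑ f : l → m, (∏ i, A i (f i)) • (B.submatrix f id).det := by
    rw [h1]
    refine (Matrix.detRowAlternating.toMultilinearMap.map_sum _).trans ?_
    refine Finset.sum_congr rfl fun f _ => ?_
    exact Matrix.detRowAlternating.toMultilinearMap.map_smul_univ (fun i => A i (f i))
      (fun i => B (f i))
  rw [h2]
  refine Ideal.sum_mem _ fun f _ => ?_
  by_cases hf : Function.Injective f
  · exact Ideal.mul_mem_left _ _ (Ideal.subset_span ⟨⟨f, hf⟩, rfl⟩)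
  · obtain ⟨i, j, hij, hne⟩ : ∃ i j, f i = f j ∧ i ≠ j := by
      simpa [Function.Injective] using hf
    rw [Matrix.det_zero_of_row_eq hne (by ext k; simp [hij]), smul_zero]
    exact Ideal.zero_mem _

/-- The determinant of `A * X * B` is a linear combination of minors of `X`. -/
theorem Matrix.det_mul_mul_mem_minorsIdeal {l m n : Type*} [Fintype l] [DecidableEq l] [Fintype m]
    [Fintype n] (A : Matrix l m S) (X : Matrix m n S) (B : Matrix n l S) {j : ℤ}
    (hj : (Fintype.card l : ℤ) = j) : (A * X * B).det ∈ minorsIdeal X j := by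
  classical
  rw [minorsIdeal]
  split_ifs with h0
  · trivial
  have hc : Fintype.card l = j.toNat := by lia
  let e : Fin j.toNat ≃ l := (Fintype.equivFinOfCardEq hc).symm
  rw [Matrix.mul_assoc]
  refine (Ideal.span_le.2 ?_) (Matrix.det_mul_mem_span_minors A (X * B))
  rintro _ ⟨r, rfl⟩
  have h1 : ((X * B).submatrix r id).det
      = (B.transpose * (X.submatrix r id).transpose).det := by
    rw [← Matrix.transpose_mul, Matrix.det_transpose]
    rfl
  rw [h1]
  refine (Ideal.span_le.2 ?_) (Matrix.det_mul_mem_span_minors _ _)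
  rintro _ ⟨c, rfl⟩
  refine Ideal.subset_span ⟨e.toEmbedding.trans r, e.toEmbedding.trans c, ?_⟩
  rw [← Matrix.det_transpose, ← Matrix.det_submatrix_equiv_self e]
  rfl

theorem Matrix.det_submatrix_mem_minorsIdeal {l m n : Type*} [Fintype l] [DecidableEq l] [Fintype m]
    [Fintype n] (X : Matrix m n S) (r : l → m) (c : l → n) {j : ℤ}
    (hj : (Fintype.card l : ℤ) = j) : (X.submatrix r c).det ∈ minorsIdeal X j := by
  classical
  have := Matrix.det_mul_mul_mem_minorsIdeal ((1 : Matrix m m S).submatrix r id) X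
    ((1 : Matrix n n S).submatrix id c) hj
  convert this
  ext i k
  simp [Matrix.mul_apply, Matrix.one_apply]

theorem minorsIdeal_mul_mul_le {m n m' n' : Type*} [Fintype m] [Fintype n]
    (A : Matrix m' m S) (X : Matrix m n S) (B : Matrix n n' S) (j : ℤ) :
    minorsIdeal (A * X * B) j ≤ minorsIdeal X j := by
  by_cases h0 : j ≤ 0
  · simp [minorsIdeal, h0]
  rw [minorsIdeal, if_neg h0, Ideal.span_le]
  rintro _ ⟨r, c, rfl⟩
  have h1 : (A * X * B).submatrix r c = A.submatrix r id * X * B.submatrix id c := by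
    ext i k
    simp [Matrix.mul_apply]
  rw [h1]
  exact Matrix.det_mul_mul_mem_minorsIdeal _ _ _ (by simp; lia)

/-- Laplace expansion. -/
theorem minorsIdeal_le_pred {m n : Type*} [Fintype m] [Fintype n] (X : Matrix m n S) (j : ℤ) :
    minorsIdeal X j ≤ minorsIdeal X (j - 1) := by
  by_cases h0 : j ≤ 0
  · simp [minorsIdeal, show j - 1 ≤ 0 by lia]
  rw [minorsIdeal, if_neg h0, Ideal.span_le]
  rintro _ ⟨r, c, rfl⟩
  obtain ⟨k, hk⟩ : ∃ k, j.toNat = k + 1 := ⟨j.toNat - 1, by lia⟩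
  have hj : j = k + 1 := by lia
  generalize j.toNat = a at *
  subst hk
  rw [Matrix.det_succ_row_zero]
  refine Ideal.sum_mem _ fun i _ => Ideal.mul_mem_left _ _ ?_
  exact Matrix.det_submatrix_mem_minorsIdeal X (r ∘ Fin.succ) (c ∘ i.succAbove) (by simp; lia)

theorem pow_mul_mem_minorsIdeal_smul {m n : Type*} [Fintype m] [Fintype n] (X : Matrix m n S)
    (u : S) (j : ℤ) {d : S} (hd : d ∈ minorsIdeal X j) :
    u ^ j.toNat * d ∈ minorsIdeal (u • X) j := by
  by_cases h0 : j ≤ 0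
  · simp [minorsIdeal, h0]
  suffices minorsIdeal X j ≤
      Submodule.comap (LinearMap.mulLeft S (u ^ j.toNat)) (minorsIdeal (u • X) j) from this hd
  rw [minorsIdeal, if_neg h0, Ideal.span_le]
  rintro _ ⟨r, c, rfl⟩
  change u ^ j.toNat * (X.submatrix r c).det ∈ minorsIdeal (u • X) j
  have h1 : u ^ j.toNat * (X.submatrix r c).det = ((u • X).submatrix r c).det := by
    have : (u • X).submatrix r c = u • X.submatrix r c := rfl
    rw [this, Matrix.det_smul, Fintype.card_fin]
  rw [h1]
  exact Matrix.det_submatrix_mem_minorsIdeal _ _ _ (by simp; lia)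

/-- If the maximal minors of `X` lie in `I`, then the submaximal minors of `X` are coordinates of
vectors killed by `X` modulo `I`: expanding a determinant along a row of variables yields such a
vector (Cramer's rule). -/
theorem minorsIdeal_le_kernelCoordIdeal {m : Type*} [Fintype m] {k : ℕ} {I : Ideal S}
    (X : Matrix m (Fin (k + 1)) S) (hI : ∀ r : Fin (k + 1) → m, (X.submatrix r id).det ∈ I) :
    minorsIdeal X k ≤ kernelCoordIdeal I X := by
  have key (r : Fin k → m) (c : Fin k ↪ Fin (k + 1)) :
      (X.submatrix r c).det ∈ kernelCoordIdeal I X := by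
    -- `M w` is the matrix with first row `w` above the chosen rows of `X`; `v` is the vector of
    -- coefficients of its determinant, as a linear form in `w`.
    let M (w : Fin (k + 1) → S) : Matrix (Fin (k + 1)) (Fin (k + 1)) S :=
      Matrix.of (Fin.cons w fun i => X (r i))
    let v : Fin (k + 1) → S := fun j => (M (Pi.single j 1)).det
    have hM (w : Fin (k + 1) → S) : (M w).det = w ⬝ᵥ v := by
      have h1 (w' : Fin (k + 1) → S) : M w' = (M 0).updateRow 0 w' := by
        ext i j
        refine Fin.cases ?_ (fun i => ?_) i <;> simp [M]
      have h2 : w = ∑ j, w j • Pi.single j (1 : S) := by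
        ext i; simp [Finset.sum_apply, Pi.single_apply]
      conv_lhs => rw [h1, h2]
      rw [dotProduct]
      have h3 := Matrix.detRowAlternating.toMultilinearMap.map_update_sum
        (t := Finset.univ) (i := 0) (g := fun j => w j • Pi.single j (1 : S)) (m := M 0)
      refine h3.trans (Finset.sum_congr rfl fun j _ => ?_)
      refine (Matrix.det_updateRow_smul (M 0) 0 (w j) _).trans ?_
      rw [← h1]
    have hv (i : m) : X.mulVec v i ∈ I := by
      have h1 : X.mulVec v i = (X.submatrix (Fin.cons i r : Fin (k + 1) → m) id).det := by
        refine (hM (X i)).symm.trans (congrArg _ ?_)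
        ext a b
        refine Fin.cases ?_ (fun a => ?_) a <;> simp [M]
      rw [h1]
      exact hI _
    obtain ⟨j, hj⟩ : ∃ j, j ∉ Set.range c := by
      by_contra! h
      have := Fintype.card_le_of_surjective c h
      simp at this
    have hinj : Function.Injective (Fin.cons j c : Fin (k + 1) → Fin (k + 1)) :=
      Fin.cons_injective_iff.2 ⟨hj, c.injective⟩
    let σ : Equiv.Perm (Fin (k + 1)) := Equiv.ofBijective _ (Finite.injective_iff_bijective.1 hinj)
    have h1 : (X.submatrix r c).det = ((M (Pi.single j 1)).submatrix id σ).det := by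
      rw [Matrix.det_succ_row_zero, Finset.sum_eq_single 0]
      · simp [M, σ]
        rfl
      · intro b _ hb
        have h2 : σ b ≠ j := fun h => hb (σ.injective (h.trans (by simp [σ])))
        simp [M, h2]
      · simp
    rw [h1, Matrix.det_permute']
    exact Ideal.mul_mem_left _ _ (mem_kernelCoordIdeal hv j)
  rw [minorsIdeal]
  split_ifs with h0
  · have : k = 0 := by lia
    subst this
    rw [top_le_iff, Ideal.eq_top_iff_one]
    simpa using key Fin.elim0 ⟨Fin.elim0, fun a => a.elim0⟩
  · rw [Ideal.span_le]
    rintro _ ⟨r, c, rfl⟩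
    exact key r c

/-- The determinant of a matrix that is triangular with respect to some total ordering of its index
set, given by an injective map `b`. -/
theorem Matrix.BlockTriangular.det_eq_prod_diag {l : Type*} [Fintype l] [DecidableEq l]
    {M : Matrix l l S} {b : l → ℕ} (hM : M.BlockTriangular b) (hb : Function.Injective b) :
    M.det = ∏ i, M i i := by
  let inst : LinearOrder l := LinearOrder.lift' b hb
  have h1 : M.BlockTriangular (id : l → l) := fun i j hij => hM hij
  convert Matrix.det_of_isUpperTriangular h1

end Minors

/-! ### Staircases of monomials and their resolutions -/

section Bivariate

variable {K : Type*} [Field K]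

/-- The exponent vector `(i, j)`. -/
noncomputable def biExp (i j : ℕ) : Fin 2 →₀ ℕ := Finsupp.equivFunOnFinite.symm ![i, j]

@[simp] theorem biExp_zero (i j : ℕ) : biExp i j 0 = i := rfl

@[simp] theorem biExp_one (i j : ℕ) : biExp i j 1 = j := rfl

theorem biExp_le_iff {i j : ℕ} {s : Fin 2 →₀ ℕ} : biExp i j ≤ s ↔ i ≤ s 0 ∧ j ≤ s 1 := by
  rw [Finsupp.le_def, Fin.forall_fin_two]; rfl

theorem biExp_eta (s : Fin 2 →₀ ℕ) : biExp (s 0) (s 1) = s := by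
  ext i; fin_cases i <;> rfl

theorem biExp_add (i j k l : ℕ) : biExp i j + biExp k l = biExp (i + k) (j + l) := by
  ext x; fin_cases x <;> rfl

theorem biExp_sub (i j k l : ℕ) : biExp i j - biExp k l = biExp (i - k) (j - l) := by
  ext x; fin_cases x <;> rfl

variable (K) in
/-- The monomial `xⁱ yʲ`. -/
noncomputable def biMon (i j : ℕ) : MvPolynomial (Fin 2) K := MvPolynomial.monomial (biExp i j) 1

theorem biMon_mul (i j k l : ℕ) : biMon K i j * biMon K k l = biMon K (i + k) (j + l) := by
  rw [biMon, biMon, MvPolynomial.monomial_mul, biExp_add, one_mul, biMon]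

theorem biMon_zero_zero : biMon K 0 0 = 1 := by
  have : biExp 0 0 = 0 := by ext x; fin_cases x <;> rfl
  rw [biMon, this]; rfl

theorem biMon_ne_zero (i j : ℕ) : biMon K i j ≠ 0 := by
  simp [biMon]

theorem biMon_eq (i j : ℕ) :
    biMon K i j = MvPolynomial.X 0 ^ i * MvPolynomial.X 1 ^ j := by
  rw [MvPolynomial.X_pow_eq_monomial, MvPolynomial.X_pow_eq_monomial, MvPolynomial.monomial_mul,
    one_mul, biMon]
  congr 2
  ext x; fin_cases x <;> simp

theorem coeff_biMon_mul (i j s t : ℕ) (p : MvPolynomial (Fin 2) K) :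
    (biMon K i j * p).coeff (biExp s t) =
      if i ≤ s ∧ j ≤ t then p.coeff (biExp (s - i) (t - j)) else 0 := by
  rw [biMon, MvPolynomial.coeff_monomial_mul', biExp_sub, one_mul]
  simp only [biExp_le_iff, biExp_zero, biExp_one]

theorem prod_biMon {ι : Type*} (s : Finset ι) (A B : ι → ℕ) :
    ∏ i ∈ s, biMon K (A i) (B i) = biMon K (∑ i ∈ s, A i) (∑ i ∈ s, B i) := by
  classical
  induction s using Finset.induction_on with
  | empty => simp [biMon_zero_zero]
  | insert i s hi ih => rw [Finset.prod_insert hi, ih, biMon_mul, Finset.sum_insert hi,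
      Finset.sum_insert hi]

/-- A power of `y` dividing a multiple of a power of `x` divides the cofactor. -/
theorem biMon_dvd_of_dvd_mul {i j : ℕ} {p : MvPolynomial (Fin 2) K}
    (h : biMon K 0 j ∣ biMon K i 0 * p) : biMon K 0 j ∣ p := by
  rw [biMon_eq, biMon_eq] at *
  simp only [pow_zero, one_mul, mul_one] at *
  have hp : Prime (MvPolynomial.X 1 : MvPolynomial (Fin 2) K) := MvPolynomial.X_prime
  refine hp.pow_dvd_of_dvd_mul_left j (fun hd => ?_) h
  have h1 := hp.dvd_of_dvd_pow hd
  rw [MvPolynomial.X_dvd_X] at h1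
  simp at h1

/-- The exponents `(a i, b i)`, `i ≤ N`, form a staircase. -/
structure IsStaircase (a b : ℕ → ℕ) (N : ℕ) : Prop where
  fst_lt : ∀ i < N, a (i + 1) < a i
  snd_lt : ∀ i < N, b i < b (i + 1)

namespace IsStaircase

variable {a b : ℕ → ℕ} {N : ℕ}

theorem fst_le (h : IsStaircase a b N) {i j : ℕ} (hij : i ≤ j) (hj : j ≤ N) : a j ≤ a i := by
  induction j, hij using Nat.le_induction with
  | base => rfl
  | succ j _ ih => exact (h.fst_lt j hj).le.trans (ih (by lia))

theorem snd_le (h : IsStaircase a b N) {i j : ℕ} (hij : i ≤ j) (hj : j ≤ N) : b i ≤ b j := by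
  induction j, hij using Nat.le_induction with
  | base => rfl
  | succ j _ ih => exact (ih (by lia)).trans (h.snd_lt j hj).le

end IsStaircase

variable (K) in
/-- The ideal generated by the monomials with exponents `(a i, b i)`, `i ≤ N`. -/
noncomputable def staircaseIdeal (a b : ℕ → ℕ) (N : ℕ) : Ideal (MvPolynomial (Fin 2) K) :=
  Ideal.span (Set.range fun i : Fin (N + 1) => biMon K (a i) (b i))

theorem mem_staircaseIdeal {a b : ℕ → ℕ} {N : ℕ} {p : MvPolynomial (Fin 2) K} :
    p ∈ staircaseIdeal K a b N ↔ ∀ m ∈ p.support, ∃ i ≤ N, a i ≤ m 0 ∧ b i ≤ m 1 := by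
  have h1 : (Set.range fun i : Fin (N + 1) => biMon K (a i) (b i)) =
      (fun s => MvPolynomial.monomial s (1 : K)) ''
        (Set.range fun i : Fin (N + 1) => biExp (a i) (b i)) := by
    rw [← Set.range_comp]; rfl
  rw [staircaseIdeal, h1, MvPolynomial.mem_ideal_span_monomial_image]
  refine forall₂_congr fun m _ => ⟨?_, ?_⟩
  · rintro ⟨_, ⟨i, rfl⟩, hi⟩
    exact ⟨i, by lia, biExp_le_iff.1 hi⟩
  · rintro ⟨i, hi, h⟩
    exact ⟨_, ⟨⟨i, by lia⟩, rfl⟩, biExp_le_iff.2 h⟩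

theorem biMon_mem_staircaseIdeal {a b : ℕ → ℕ} {N i s t : ℕ} (hi : i ≤ N) (hs : a i ≤ s)
    (ht : b i ≤ t) : biMon K s t ∈ staircaseIdeal K a b N := by
  rw [mem_staircaseIdeal]
  intro m hm
  obtain rfl := Finset.mem_singleton.1 (MvPolynomial.support_monomial_subset hm)
  exact ⟨i, hi, hs, ht⟩

variable (K) in
/-- The bidiagonal Hilbert-Burch matrix of a staircase: its `j`-th column is the syzygy
`y ^ (b (j + 1) - b j) * u j = x ^ (a j - a (j + 1)) * u (j + 1)` of neighbouring generators. -/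
noncomputable def staircaseMatrix (a b : ℕ → ℕ) (N : ℕ) :
    Matrix (Fin (N + 1)) (Fin N) (MvPolynomial (Fin 2) K) :=
  Matrix.of fun i j => (if (i : ℕ) = j then biMon K 0 (b (j + 1) - b j) else 0) -
    (if (i : ℕ) = j + 1 then biMon K (a j - a (j + 1)) 0 else 0)

/-- A vector of length `N` placed in positions `1, …, N` of a sequence that vanishes elsewhere. -/
def padOne {S : Type*} [Zero S] {N : ℕ} (v : Fin N → S) : ℕ → S
  | 0 => 0
  | i + 1 => if h : i < N then v ⟨i, h⟩ else 0

theorem padOne_succ {S : Type*} [Zero S] {N : ℕ} (v : Fin N → S) (i : Fin N) :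
    padOne v (i + 1) = v i := by
  simp [padOne]

theorem padOne_of_lt {S : Type*} [Zero S] {N : ℕ} (v : Fin N → S) {i : ℕ} (hi : N < i) :
    padOne v i = 0 := by
  cases i with
  | zero => rfl
  | succ i => simp [padOne, show ¬ i < N by lia]

theorem sum_ite_mul_eq_mul_padOne {S : Type*} [CommRing S] {N : ℕ} (v : Fin N → S) (c : ℕ → S)
    (i : ℕ) : ∑ j : Fin N, (if i = j then c j else 0) * v j = c i * padOne v (i + 1) := by
  by_cases h : i < N
  · rw [Finset.sum_eq_single ⟨i, h⟩]
    · simp [padOne, h]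
    · intro j _ hj
      rw [if_neg (fun hij => hj (Fin.ext hij.symm)), zero_mul]
    · simp
  · rw [padOne_of_lt v (by lia), mul_zero]
    exact Finset.sum_eq_zero fun j _ => by rw [if_neg (by lia), zero_mul]

/-- The `i`-th coordinate of the product of the staircase matrix with a sequence `w`. -/
noncomputable def staircaseRow (a b : ℕ → ℕ) (w : ℕ → MvPolynomial (Fin 2) K) (i : ℕ) :
    MvPolynomial (Fin 2) K :=
  biMon K 0 (b (i + 1) - b i) * w (i + 1) - biMon K (a (i - 1) - a i) 0 * w i

theorem staircaseMatrix_mulVec (a b : ℕ → ℕ) {N : ℕ} (v : Fin N → MvPolynomial (Fin 2) K)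
    (i : Fin (N + 1)) :
    (staircaseMatrix K a b N).mulVec v i = staircaseRow a b (padOne v) i := by
  simp only [Matrix.mulVec, dotProduct, staircaseMatrix, Matrix.of_apply, sub_mul,
    Finset.sum_sub_distrib, staircaseRow]
  congr 1
  · exact sum_ite_mul_eq_mul_padOne v (fun j => biMon K 0 (b (j + 1) - b j)) i
  · obtain ⟨i, hi⟩ := i
    cases i with
    | zero => simp [padOne]
    | succ i =>
      refine Eq.trans ?_ (sum_ite_mul_eq_mul_padOne v (fun j => biMon K (a j - a (j + 1)) 0) i)
      simp

theorem staircaseMatrix_injective (a b : ℕ → ℕ) (N : ℕ) :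
    Function.Injective (staircaseMatrix K a b N).mulVecLin := by
  rw [injective_iff_map_eq_zero]
  intro v hv
  have h1 (i : ℕ) (hi : i ≤ N) : padOne v i = 0 := by
    induction i with
    | zero => rfl
    | succ i ih =>
      have h2 : staircaseRow a b (padOne v) i = 0 := by
        rw [← staircaseMatrix_mulVec a b v ⟨i, by lia⟩]
        exact congrFun hv _
      rw [staircaseRow, ih (by lia), mul_zero, sub_zero] at h2
      exact (mul_eq_zero.1 h2).resolve_left (biMon_ne_zero _ _)
  ext1 i
  rw [← padOne_succ v i, h1 _ (by lia)]
  rfl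

variable (K) in
/-- The map `S^(N+1) → I` given by the generators of a staircase ideal. -/
noncomputable def staircaseMap (a b : ℕ → ℕ) (N : ℕ) :
    (Fin (N + 1) → MvPolynomial (Fin 2) K) →ₗ[MvPolynomial (Fin 2) K] staircaseIdeal K a b N :=
  (Fintype.linearCombination (MvPolynomial (Fin 2) K)
    fun i : Fin (N + 1) => biMon K (a i) (b i)).codRestrict _ fun f => by
      rw [Fintype.linearCombination_apply]
      exact Ideal.sum_mem _ fun i _ => Ideal.mul_mem_left _ _
        (Ideal.subset_span (Set.mem_range_self i))

theorem staircaseMap_apply (a b : ℕ → ℕ) (N : ℕ) (f : Fin (N + 1) → MvPolynomial (Fin 2) K) :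
    (staircaseMap K a b N f : MvPolynomial (Fin 2) K) = ∑ i, f i * biMon K (a i) (b i) := by
  simp [staircaseMap, Fintype.linearCombination_apply]

theorem staircaseMap_surjective (a b : ℕ → ℕ) (N : ℕ) :
    Function.Surjective (staircaseMap K a b N) := by
  rintro ⟨p, hp⟩
  obtain ⟨c, hc⟩ := (Ideal.mem_span_range_iff_exists_fun).1 hp
  exact ⟨c, Subtype.ext ((staircaseMap_apply a b N c).trans hc)⟩

theorem sum_staircaseRow_mul {a b : ℕ → ℕ} {N : ℕ} (h : IsStaircase a b N)
    {w : ℕ → MvPolynomial (Fin 2) K} (h0 : w 0 = 0) {k : ℕ} (hk : k ≤ N) :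
    ∑ i ∈ Finset.range k, staircaseRow a b w i * biMon K (a i) (b i) =
      biMon K (a (k - 1)) (b k) * w k := by
  induction k with
  | zero => simp [h0]
  | succ k ih =>
    rw [Finset.sum_range_succ, ih (by lia), staircaseRow]
    have h1 : biMon K 0 (b (k + 1) - b k) * biMon K (a k) (b k) = biMon K (a k) (b (k + 1)) := by
      rw [biMon_mul, zero_add, Nat.sub_add_cancel (h.snd_lt k hk).le]
    have h2 : biMon K (a (k - 1) - a k) 0 * biMon K (a k) (b k) = biMon K (a (k - 1)) (b k) := by
      rw [biMon_mul, zero_add, Nat.sub_add_cancel (h.fst_le (Nat.sub_le k 1) (by lia))]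
    rw [Nat.add_sub_cancel, ← h1, ← h2]
    ring

/-- The syzygies of a staircase ideal are solved for coordinate by coordinate: once the first `k`
coordinates vanish, the next one is divisible by the required power of `y`. -/
theorem staircase_exact {a b : ℕ → ℕ} {N : ℕ} (h : IsStaircase a b N) :
    Function.Exact (staircaseMatrix K a b N).mulVecLin (staircaseMap K a b N) := by
  intro f
  constructor
  · intro hf
    let F : ℕ → MvPolynomial (Fin 2) K := fun i => if hi : i < N + 1 then f ⟨i, hi⟩ else 0
    have hF : ∑ i ∈ Finset.range (N + 1), F i * biMon K (a i) (b i) = 0 := by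
      rw [Finset.sum_range]
      refine Eq.trans ?_ ((staircaseMap_apply a b N f).symm.trans (congrArg Subtype.val hf))
      exact Finset.sum_congr rfl fun i _ => by simp only [F, dif_pos i.2]
    have step (k : ℕ) (hk : k ≤ N) (w : ℕ → MvPolynomial (Fin 2) K) (h0 : w 0 = 0)
        (hw : ∀ i < k, staircaseRow a b w i = F i) :
        biMon K (a k) (b k) * (F k + biMon K (a (k - 1) - a k) 0 * w k) =
          - ∑ i ∈ Finset.Ico (k + 1) (N + 1), F i * biMon K (a i) (b i) := by
      have h1 := Finset.sum_range_add_sum_Ico (fun i => F i * biMon K (a i) (b i))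
        (show k + 1 ≤ N + 1 by lia)
      have h2 : ∑ i ∈ Finset.range k, F i * biMon K (a i) (b i) =
          biMon K (a (k - 1)) (b k) * w k := by
        rw [← sum_staircaseRow_mul h h0 hk]
        exact Finset.sum_congr rfl fun i hi => by rw [hw i (Finset.mem_range.1 hi)]
      have h3 : biMon K (a (k - 1) - a k) 0 * biMon K (a k) (b k) = biMon K (a (k - 1)) (b k) := by
        rw [biMon_mul, zero_add, Nat.sub_add_cancel (h.fst_le (Nat.sub_le k 1) (by lia))]
      rw [Finset.sum_range_succ, h2, ← h3, hF] at h1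
      linear_combination h1
    have ind (k : ℕ) (hk : k ≤ N) : ∃ w : ℕ → MvPolynomial (Fin 2) K, w 0 = 0 ∧
        ∀ i < k, staircaseRow a b w i = F i := by
      induction k with
      | zero => exact ⟨0, rfl, by simp⟩
      | succ k ih =>
        obtain ⟨w, h0, hw⟩ := ih (by lia)
        have h1 := step k (by lia) w h0 hw
        have h2 : biMon K 0 (b (k + 1)) ∣
            biMon K (a k) (b k) * (F k + biMon K (a (k - 1) - a k) 0 * w k) := by
          rw [h1, dvd_neg]
          refine Finset.dvd_sum fun i hi => ?_
          rw [Finset.mem_Ico] at hi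
          refine Dvd.dvd.mul_left ⟨biMon K (a i) (b i - b (k + 1)), ?_⟩ _
          rw [biMon_mul, zero_add, Nat.add_sub_cancel' (h.snd_le hi.1 (by lia))]
        have h3 : biMon K 0 (b (k + 1)) = biMon K 0 (b k) * biMon K 0 (b (k + 1) - b k) := by
          rw [biMon_mul, Nat.add_sub_cancel' (h.snd_lt k hk).le]
        have h4 : biMon K (a k) (b k) = biMon K 0 (b k) * biMon K (a k) 0 := by
          rw [biMon_mul, zero_add, add_zero]
        rw [h3, h4, mul_assoc] at h2
        obtain ⟨g, hg⟩ := biMon_dvd_of_dvd_mul ((mul_dvd_mul_iff_left (biMon_ne_zero _ _)).1 h2)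
        refine ⟨Function.update w (k + 1) g, by simpa using h0, fun i hi => ?_⟩
        rcases Nat.lt_succ_iff_lt_or_eq.1 hi with hi | rfl
        · rw [← hw i hi, staircaseRow, staircaseRow, Function.update_of_ne (by lia),
            Function.update_of_ne (by lia)]
        · rw [staircaseRow, Function.update_self, Function.update_of_ne (by lia), ← hg]
          ring
    obtain ⟨w, h0, hw⟩ := ind N le_rfl
    have hN := step N le_rfl w h0 hw
    rw [Finset.Ico_self, Finset.sum_empty, neg_zero] at hN
    have hN' := (mul_eq_zero.1 hN).resolve_left (biMon_ne_zero _ _)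
    have hpad (i : ℕ) (hi : i ≤ N) : padOne (fun j : Fin N => w (j + 1)) i = w i := by
      cases i with
      | zero => exact h0.symm
      | succ i => exact padOne_succ _ ⟨i, hi⟩
    refine ⟨fun j => w (j + 1), funext fun i => ?_⟩
    refine (staircaseMatrix_mulVec a b _ i).trans ?_
    have hFi : F i = f i := by simp only [F, dif_pos i.2]
    rw [← hFi]
    rcases Nat.lt_succ_iff_lt_or_eq.1 i.2 with hi | hi
    · rw [← hw i hi, staircaseRow, staircaseRow, hpad _ hi.le, hpad _ hi]
    · rw [hi, staircaseRow, hpad _ le_rfl, padOne_of_lt _ (Nat.lt_succ_self N)]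
      linear_combination -hN'
  · rintro ⟨v, rfl⟩
    refine Subtype.ext ?_
    rw [staircaseMap_apply]
    have h1 := sum_staircaseRow_mul h (w := padOne v) rfl (le_refl N)
    have h2 : ∑ i : Fin (N + 1), staircaseRow a b (padOne v) i * biMon K (a i) (b i) = 0 := by
      rw [← Finset.sum_range fun i => staircaseRow a b (padOne v) i * biMon K (a i) (b i),
        Finset.sum_range_succ, h1, staircaseRow, padOne_of_lt v (Nat.lt_succ_self N)]
      have h3 : biMon K (a (N - 1) - a N) 0 * biMon K (a N) (b N) = biMon K (a (N - 1)) (b N) := by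
        rw [biMon_mul, zero_add, Nat.sub_add_cancel (h.fst_le (Nat.sub_le N 1) le_rfl)]
      rw [← h3]
      ring
    refine Eq.trans (Finset.sum_congr rfl fun i _ => ?_) h2
    rw [← staircaseMatrix_mulVec]
    rfl

end Bivariate

/-! ### The trace in terms of the staircase matrix -/

section StaircaseTrace

variable {K : Type*} [Field K] {a b : ℕ → ℕ} {N : ℕ}

/-- The horizontal steps between positions `p` and `k`, and beyond `q`. -/
theorem IsStaircase.sum_fst_steps (h : IsStaircase a b N) {p k q : ℕ} (hpk : p ≤ k) (hkq : k < q)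
    (hq : q ≤ N) :
    (∑ j ∈ Finset.range N, if j < p then 0 else if j < k then a j - a (j + 1) else
      if j < q then 0 else a j - a (j + 1)) = a p - a k + (a q - a N) := by
  have h1 (n : ℕ) (hn : n ≤ N) : (∑ j ∈ Finset.range n, if j < p then 0 else
      if j < k then a j - a (j + 1) else if j < q then 0 else a j - a (j + 1)) =
      if n ≤ p then 0 else if n ≤ k then a p - a n else if n ≤ q then a p - a k
        else a p - a k + (a q - a n) := by
    induction n with
    | zero => simp
    | succ n ih =>
      rw [Finset.sum_range_succ, ih (by lia)]
      have h1 := h.fst_lt n hn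
      have h2 : p ≤ n → a n ≤ a p := fun hp => h.fst_le hp (by lia)
      have h3 : q ≤ n → a n ≤ a q := fun hp => h.fst_le hp (by lia)
      have h4 : p = n → a p = a n := fun hp => by rw [hp]
      have h5 : q = n → a q = a n := fun hp => by rw [hp]
      have h6 : k = n → a k = a n := fun hp => by rw [hp]
      have h7 : k = n + 1 → a k = a (n + 1) := fun hp => by rw [hp]
      clear ih h
      split_ifs <;> omega
  rw [h1 N le_rfl]
  have h2 : p = k → a p = a k := fun hp => by rw [hp]
  have h3 : q = N → a q = a N := fun hp => by rw [hp]
  clear h1 h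
  split_ifs <;> omega

/-- The vertical steps up to position `p`, and between positions `k + 1` and `q`. -/
theorem IsStaircase.sum_snd_steps (h : IsStaircase a b N) {p k q : ℕ} (hpk : p ≤ k) (hkq : k < q)
    (hq : q ≤ N) :
    (∑ j ∈ Finset.range N, if j < p then b (j + 1) - b j else if j ≤ k then 0 else
      if j < q then b (j + 1) - b j else 0) = b p - b 0 + (b q - b (k + 1)) := by
  have h1 (n : ℕ) (hn : n ≤ N) : (∑ j ∈ Finset.range n, if j < p then b (j + 1) - b j else
      if j ≤ k then 0 else if j < q then b (j + 1) - b j else 0) =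
      if n ≤ p then b n - b 0 else if n ≤ k + 1 then b p - b 0 else
        if n ≤ q then b p - b 0 + (b n - b (k + 1)) else b p - b 0 + (b q - b (k + 1)) := by
    induction n with
    | zero => simp
    | succ n ih =>
      rw [Finset.sum_range_succ, ih (by lia)]
      have h1 := h.snd_lt n hn
      have h2 : k + 1 ≤ n → b (k + 1) ≤ b n := fun hp => h.snd_le hp (by lia)
      have h3 : b 0 ≤ b n := h.snd_le (Nat.zero_le n) (by lia)
      have h4 : p = n → b p = b n := fun hp => by rw [hp]
      have h5 : q = n → b q = b n := fun hp => by rw [hp]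
      have h6 : k + 1 = n → b (k + 1) = b n := fun hp => by rw [hp]
      clear ih h
      split_ifs <;> omega
  rw [h1 N le_rfl]
  have h3 : q = N → b q = b N := fun hp => by rw [hp]
  have h4 : k + 1 = N → b (k + 1) = b N := fun hp => by rw [hp]
  clear h1 h
  split_ifs <;> omega

/-- Deleting the rows `p`, `q` and the column `k`, `p ≤ k < q`, from the staircase matrix leaves a
matrix that is, up to the order of the indices, triangular; its determinant is
`± x ^ (a p - a k + a q) * y ^ (b p + b q - b (k + 1))`. -/
theorem biMon_mem_minorsIdeal_staircaseMatrix (h : IsStaircase a b N) (ha : a N = 0) (hb : b 0 = 0)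
    {p k q : ℕ} (hpk : p ≤ k) (hkq : k < q) (hq : q ≤ N) :
    biMon K (a p - a k + a q) (b p + (b q - b (k + 1))) ∈
      minorsIdeal (staircaseMatrix K a b N) (N - 1) := by
  let k' : Fin N := ⟨k, by lia⟩
  let l := {j : Fin N // j ≠ k'}
  -- The diagonal entry in column `j` is a power of `y` if `P j` holds, and a power of `x` otherwise.
  let P : ℕ → Prop := fun j => j < p ∨ (k < j ∧ j < q)
  have : DecidablePred P := fun j => inferInstanceAs (Decidable (_ ∨ _))
  let r : l → Fin (N + 1) := fun j => if P j.1 then j.1.castSucc else j.1.succ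
  let M : Matrix l l (MvPolynomial (Fin 2) K) := (staircaseMatrix K a b N).submatrix r Subtype.val
  -- The order of the indices: a column meets only rows belonging to its own run of powers of `y`
  -- or of `x`, and these runs are traversed in opposite directions.
  let β : l → ℕ := fun j => if P j.1 then 2 * (N - j.1) + 1 else 2 * j.1
  have hk' (j : l) : (j.1 : ℕ) ≠ k := fun hj => j.2 (Fin.ext hj)
  have hr (j : l) : (r j : ℕ) = if P j.1 then (j.1 : ℕ) else j.1 + 1 := by
    simp only [r]; split_ifs <;> rfl
  have hβ : Function.Injective β := by
    intro i j hij
    apply Subtype.ext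
    apply Fin.ext
    have := i.1.2
    have := j.1.2
    simp only [β] at hij
    split_ifs at hij <;> omega
  have htri : M.BlockTriangular β := by
    intro i j hij
    have hi := hk' i
    have hj := hk' j
    have := i.1.2
    have := j.1.2
    simp only [β] at hij
    have h1 : (r i : ℕ) ≠ j.1 ∧ (r i : ℕ) ≠ j.1 + 1 := by
      rw [hr]
      simp only [P] at hij ⊢
      split_ifs at hij ⊢ <;> omega
    simp [M, staircaseMatrix, h1.1, h1.2]
  let A : ℕ → ℕ := fun j => if j < p then 0 else if j < k then a j - a (j + 1) else
    if j < q then 0 else a j - a (j + 1)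
  let B : ℕ → ℕ := fun j => if j < p then b (j + 1) - b j else if j ≤ k then 0 else
    if j < q then b (j + 1) - b j else 0
  have hdiag (j : l) : M j j = (if P j.1 then 1 else -1) * biMon K (A j.1) (B j.1) := by
    have hj := hk' j
    by_cases hP : P j.1
    · have h1 : (r j : ℕ) = j.1 := by rw [hr, if_pos hP]
      have hA : A j.1 = 0 := by
        simp only [A, P] at hP ⊢
        split_ifs <;> omega
      have hB : B j.1 = b (j.1 + 1) - b j.1 := by
        simp only [B, P] at hP ⊢
        split_ifs <;> omega
      simp [M, staircaseMatrix, h1, hP, hA, hB]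
    · have h1 : (r j : ℕ) = j.1 + 1 := by rw [hr, if_neg hP]
      have hA : A j.1 = a j.1 - a (j.1 + 1) := by
        simp only [A, P] at hP ⊢
        split_ifs <;> omega
      have hB : B j.1 = 0 := by
        simp only [B, P] at hP ⊢
        split_ifs <;> omega
      simp [M, staircaseMatrix, h1, hP, hA, hB]
  have hAk : A k = 0 := by simp only [A]; split_ifs <;> omega
  have hBk : B k = 0 := by simp only [B]; split_ifs <;> omega
  have hsum (F : ℕ → ℕ) (hF : F k = 0) : ∑ j : l, F j.1 = ∑ j ∈ Finset.range N, F j := by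
    have h1 : ∑ j ∈ Finset.univ.erase k', F j = ∑ j : l, F j.1 :=
      Finset.sum_subtype _ (by simp) _
    rw [Finset.sum_range, ← Finset.sum_erase (a := k') Finset.univ hF, h1]
  have hsumA : ∑ j ∈ Finset.range N, A j = a p - a k + a q := by
    rw [h.sum_fst_steps hpk hkq hq, ha, Nat.sub_zero]
  have hsumB : ∑ j ∈ Finset.range N, B j = b p + (b q - b (k + 1)) := by
    rw [h.sum_snd_steps hpk hkq hq, hb, Nat.sub_zero]
  have hdet : M.det = (∏ j : l, if P j.1 then 1 else -1) *
      biMon K (a p - a k + a q) (b p + (b q - b (k + 1))) := by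
    rw [htri.det_eq_prod_diag hβ, Finset.prod_congr rfl fun j _ => hdiag j, Finset.prod_mul_distrib,
      prod_biMon, hsum A hAk, hsum B hBk, hsumA, hsumB]
  have hmem : M.det ∈ minorsIdeal (staircaseMatrix K a b N) (N - 1) := by
    refine Matrix.det_submatrix_mem_minorsIdeal _ _ _ ?_
    rw [Fintype.card_subtype_compl, Fintype.card_fin, Fintype.card_subtype_eq]
    omega
  rw [hdet] at hmem
  refine (Ideal.unit_mul_mem_iff_mem _ ?_).1 hmem
  rw [IsUnit.prod_univ_iff]
  intro j
  split_ifs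
  exacts [isUnit_one, isUnit_one.neg]

/-- The heart of the matter: modulo a staircase ideal, every vector killed by the staircase matrix
has its coordinates in the ideal of submaximal minors. The coefficients of the vector in a fixed
multidegree change from one position to the next only where the corresponding row produces an
element of the ideal. They vanish beyond both ends, so each nonzero coefficient in position `k`
yields rows `p ≤ k < q` with such elements, and then a minor that divides the monomial. -/
theorem kernelCoordIdeal_staircaseMatrix_le (h : IsStaircase a b N) (ha : a N = 0) (hb : b 0 = 0) :
    kernelCoordIdeal (staircaseIdeal K a b N) (staircaseMatrix K a b N) ≤
      minorsIdeal (staircaseMatrix K a b N) (N - 1) := by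
  rw [kernelCoordIdeal, Ideal.span_le]
  rintro _ ⟨v, hv, k, rfl⟩
  rw [SetLike.mem_coe, (v k).as_sum]
  refine Ideal.sum_mem _ fun m hm => ?_
  have hk := k.2
  let s := m 0 + a k
  let t := m 1 + b (k + 1)
  let lam : ℕ → K := fun j => if a (j - 1) ≤ s ∧ b j ≤ t then
    (padOne v j).coeff (biExp (s - a (j - 1)) (t - b j)) else 0
  let rho : ℕ → K := fun i => if a i ≤ s ∧ b i ≤ t then
    (staircaseRow a b (padOne v) i).coeff (biExp (s - a i) (t - b i)) else 0
  have hlam0 : lam 0 = 0 := by simp [lam, padOne]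
  have hlamN : lam (N + 1) = 0 := by simp [lam, padOne_of_lt v (Nat.lt_succ_self N)]
  have hlamk : lam (k + 1) ≠ 0 := by
    simp only [lam, Nat.add_sub_cancel, padOne_succ, s, t]
    rw [if_pos ⟨by lia, by lia⟩, biExp_eta]
    exact MvPolynomial.mem_support_iff.1 hm
  have hrho (i : ℕ) (hi : i ≤ N) : rho i = lam (i + 1) - lam i := by
    have h1 : a i ≤ a (i - 1) := h.fst_le (Nat.sub_le i 1) hi
    have h2 : i < N → b i < b (i + 1) := h.snd_lt i
    have h3 : N ≤ i → padOne v (i + 1) = 0 := fun h => padOne_of_lt v (by lia)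
    simp only [rho, lam, staircaseRow, MvPolynomial.coeff_sub, coeff_biMon_mul, Nat.add_sub_cancel,
      zero_le, true_and, and_true, Nat.sub_zero]
    by_cases hN : i < N
    · have h2 := h2 hN
      have e1 : t - b i - (b (i + 1) - b i) = t - b (i + 1) := by lia
      have e2 : s - a i - (a (i - 1) - a i) = s - a (i - 1) := by lia
      rw [e1, e2]
      split_ifs <;> first | rfl | (exfalso; lia) | simp
    · have e2 : s - a i - (a (i - 1) - a i) = s - a (i - 1) := by lia
      rw [h3 (by lia), e2]
      simp only [MvPolynomial.coeff_zero, ite_self]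
      split_ifs <;> first | rfl | (exfalso; lia) | simp
  -- A nonzero `rho i` means that the `i`-th row contributes a monomial of the ideal.
  have hrow (i : ℕ) (hi : i ≤ N) (hne : rho i ≠ 0) :
      ∃ j ≤ N, a i + a j ≤ s ∧ b i + b j ≤ t := by
    have hcond : a i ≤ s ∧ b i ≤ t := by
      by_contra hc
      exact hne (if_neg hc)
    have h1 := hv ⟨i, by lia⟩
    rw [staircaseMatrix_mulVec, mem_staircaseIdeal] at h1
    simp only [rho, if_pos hcond] at hne
    obtain ⟨j, hj, h2, h3⟩ := h1 _ (MvPolynomial.mem_support_iff.2 hne)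
    rw [biExp_zero] at h2
    rw [biExp_one] at h3
    exact ⟨j, hj, by lia, by lia⟩
  obtain ⟨p, hp, hpne⟩ : ∃ p ∈ Finset.range (k + 1), rho p ≠ 0 := by
    apply Finset.exists_ne_zero_of_sum_ne_zero
    rw [Finset.sum_congr rfl fun i hi => hrho i (by rw [Finset.mem_range] at hi; lia),
      Finset.sum_range_sub, hlam0, sub_zero]
    exact hlamk
  obtain ⟨q, hq, hqne⟩ : ∃ q ∈ Finset.Ico (k + 1 : ℕ) (N + 1), rho q ≠ 0 := by
    apply Finset.exists_ne_zero_of_sum_ne_zero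
    rw [Finset.sum_congr rfl fun i hi => hrho i (by rw [Finset.mem_Ico] at hi; lia),
      Finset.sum_Ico_sub lam (by lia), hlamN, zero_sub]
    exact neg_ne_zero.2 hlamk
  rw [Finset.mem_range] at hp
  rw [Finset.mem_Ico] at hq
  obtain ⟨i, hi, hi1, hi2⟩ := hrow p (by lia) hpne
  obtain ⟨j, hj, hj1, hj2⟩ := hrow q (by lia) hqne
  -- The two rows give pairs `(p, i)` and `(q, j)`. One of them straddles `k`, or else `(p, j)` does,
  -- by the monotonicity of the two exponents.
  obtain ⟨p', q', hp', hq', hq'N, h1, h2⟩ : ∃ p' q' : ℕ, p' ≤ (k : ℕ) ∧ (k : ℕ) < q' ∧ q' ≤ N ∧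
      a p' + a q' ≤ s ∧ b p' + b q' ≤ t := by
    by_cases hik : (k : ℕ) < i
    · exact ⟨p, i, by lia, hik, hi, hi1, hi2⟩
    by_cases hjk : j ≤ (k : ℕ)
    · exact ⟨j, q, hjk, by lia, by lia, by lia, by lia⟩
    have h3 : a j ≤ a i := h.fst_le (by lia) hj
    have h4 : b p ≤ b q := h.snd_le (by lia) (by lia)
    exact ⟨p, j, by lia, by lia, hj, by lia, by lia⟩
  have h3 : a k ≤ a p' := h.fst_le hp' (by lia)
  have h4 : b (k + 1) ≤ b q' := h.snd_le hq' hq'N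
  have h5 : MvPolynomial.monomial m ((v k).coeff m) = MvPolynomial.C ((v k).coeff m) *
      biMon K (m 0 - (a p' - a k + a q')) (m 1 - (b p' + (b q' - b (k + 1)))) *
      biMon K (a p' - a k + a q') (b p' + (b q' - b (k + 1))) := by
    rw [mul_assoc, biMon_mul, Nat.sub_add_cancel (by lia), Nat.sub_add_cancel (by lia), biMon,
      biExp_eta, MvPolynomial.C_mul_monomial, mul_one]
  rw [h5]
  exact Ideal.mul_mem_left _ _ (biMon_mem_minorsIdeal_staircaseMatrix h ha hb hp' hq' hq'N)

end StaircaseTrace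

/-! ### Monomial ideals with Cohen-Macaulay quotient -/

section MonomialIdeals

variable {K : Type*} [Field K]

/-- Every nonzero monomial ideal in two variables is a staircase ideal: its finitely many minimal
monomials form an antichain, so sorting them by the exponent of `y` sorts them in the opposite order
by the exponent of `x`. -/
theorem exists_eq_staircaseIdeal {I : Ideal (MvPolynomial (Fin 2) K)}
    (hI : IsMonomialIdeal I) (h0 : I ≠ ⊥) :
    ∃ (a b : ℕ → ℕ) (N : ℕ), IsStaircase a b N ∧ I = staircaseIdeal K a b N := by
  classical
  obtain ⟨A, rfl⟩ := hI
  let B : Set (Fin 2 →₀ ℕ) := {s | Minimal (· ∈ A) s}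
  have hB : B.Finite := WellQuasiOrderedLE.finite_of_isAntichain (setOfPred_minimal_antichain _)
  have hle (s t : Fin 2 →₀ ℕ) : s ≤ t ↔ s 0 ≤ t 0 ∧ s 1 ≤ t 1 := by
    rw [Finsupp.le_def, Fin.forall_fin_two]
  let F : Finset ℕ := hB.toFinset.image fun s => s 1
  have hF (j : ℕ) : j ∈ F ↔ ∃ s ∈ B, s 1 = j := by simp [F]
  have hAne : A.Nonempty := by
    rw [Set.nonempty_iff_ne_empty]
    rintro rfl
    simp at h0
  have hmin (s) (hs : s ∈ A) : ∃ t ≤ s, t ∈ B := exists_minimal_le_of_wellFoundedLT _ s hs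
  obtain ⟨N, hN⟩ : ∃ N, F.card = N + 1 := by
    obtain ⟨s, hs⟩ := hAne
    obtain ⟨t, -, ht⟩ := hmin s hs
    have : 0 < F.card := Finset.card_pos.2 ⟨t 1, (hF _).2 ⟨t, ht, rfl⟩⟩
    exact ⟨F.card - 1, by lia⟩
  let e := F.orderEmbOfFin hN
  choose s hsB hs using fun i : Fin (N + 1) => (hF (e i)).1 (F.orderEmbOfFin_mem hN i)
  let c : ℕ → Fin 2 →₀ ℕ := fun i => s (Fin.ofNat (N + 1) i)
  have hc (i : Fin (N + 1)) : c i = s i := by simp [c]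
  refine ⟨fun i => c i 0, fun i => c i 1, N, ?_, ?_⟩
  · have hlt (i : ℕ) (hi : i < N) : c i 1 < c (i + 1) 1 := by
      have h1 := hc ⟨i, by lia⟩
      have h2 := hc ⟨i + 1, by lia⟩
      simp only at h1 h2
      rw [h1, h2, hs, hs]
      exact e.strictMono (by simp)
    refine ⟨fun i hi => ?_, hlt⟩
    by_contra! hcon
    have h1 : c (i + 1) ≤ c i := (hsB _).le_of_le (hsB _).prop
      ((hle _ _).2 ⟨hcon, (hlt i hi).le⟩)
    exact absurd ((hle _ _).1 h1).2 (by have := hlt i hi; lia)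
  · apply le_antisymm
    · rw [Ideal.span_le]
      rintro _ ⟨t, ht, rfl⟩
      obtain ⟨t', ht', htB⟩ := hmin t ht
      have h1 : t' 1 ∈ Set.range e := by
        rw [Finset.range_orderEmbOfFin]
        exact (hF _).2 ⟨t', htB, rfl⟩
      obtain ⟨i, hi⟩ := h1
      have h2 : s i = t' := by
        rcases le_total (s i 0) (t' 0) with h | h
        · exact htB.eq_of_le (hsB i).prop ((hle _ _).2 ⟨h, by rw [hs, hi]⟩)
        · exact ((hsB i).eq_of_le htB.prop ((hle _ _).2 ⟨h, by rw [hs, hi]⟩)).symm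
      have h3 := (hle _ _).1 ht'
      have h4 := biMon_mem_staircaseIdeal (K := K) (a := fun i => c i 0) (b := fun i => c i 1)
        (N := N) (i := i) (s := t 0) (t := t 1) (by lia) (by simpa [hc, h2] using h3.1)
        (by simpa [hc, h2] using h3.2)
      rwa [biMon, biExp_eta] at h4
    · rw [staircaseIdeal, Ideal.span_le]
      rintro _ ⟨i, rfl⟩
      refine Ideal.subset_span ⟨c i, (hsB _).prop, ?_⟩
      exact congrArg (fun m => MvPolynomial.monomial m (1 : K)) (biExp_eta (c i)).symm

/-- The monomial in the inner corner between the first two steps of a staircase is a socle element: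
it is not in the ideal, but its product with every polynomial without constant term is. -/
theorem exists_socle_staircaseIdeal {a b : ℕ → ℕ} {N : ℕ} (h : IsStaircase a b N) (hN : 1 ≤ N) :
    ∃ z ∉ staircaseIdeal K a b N, ∀ w : MvPolynomial (Fin 2) K,
      MvPolynomial.constantCoeff w = 0 → z * w ∈ staircaseIdeal K a b N := by
  have ha := h.fst_lt 0 hN
  have hb := h.snd_lt 0 hN
  rw [zero_add] at ha hb
  refine ⟨biMon K (a 0 - 1) (b 1 - 1), fun hz => ?_, fun w hw => ?_⟩
  · rw [mem_staircaseIdeal] at hz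
    obtain ⟨i, hi, h1, h2⟩ := hz (biExp (a 0 - 1) (b 1 - 1)) (by simp [biMon])
    rw [biExp_zero] at h1
    rw [biExp_one] at h2
    rcases Nat.eq_zero_or_pos i with rfl | hi0
    · lia
    · have := h.snd_le hi0 hi
      lia
  · rw [mem_staircaseIdeal]
    intro m hm
    rw [MvPolynomial.mem_support_iff, ← biExp_eta m, coeff_biMon_mul] at hm
    have h1 : a 0 - 1 ≤ m 0 ∧ b 1 - 1 ≤ m 1 := by
      by_contra hc
      exact hm (if_neg hc)
    rw [if_pos h1] at hm
    by_cases h2 : a 0 ≤ m 0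
    · exact ⟨0, by lia, h2, by lia⟩
    by_cases h3 : b 1 ≤ m 1
    · exact ⟨1, hN, by lia, h3⟩
    refine absurd ?_ hm
    have h4 : biExp (m 0 - (a 0 - 1)) (m 1 - (b 1 - 1)) = 0 := by
      ext x
      fin_cases x
      · change m 0 - (a 0 - 1) = 0; lia
      · change m 1 - (b 1 - 1) = 0; lia
    rw [h4]
    exact hw

/-- If a quotient of the polynomial ring is Cohen-Macaulay and has a socle element at the origin,
then its depth there is zero, hence so is its dimension: no prime containing `I` lies strictly below
the maximal ideal of the origin. -/
theorem ker_constantCoeff_le_of_socle {I : Ideal (MvPolynomial (Fin 2) K)}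
    (hCM : IsCohenMacaulay (MvPolynomial (Fin 2) K ⧸ I))
    (hI : I ≤ RingHom.ker (MvPolynomial.constantCoeff (R := K) (σ := Fin 2)))
    {z : MvPolynomial (Fin 2) K} (hz : z ∉ I)
    (hzI : ∀ w, MvPolynomial.constantCoeff w = 0 → z * w ∈ I)
    {Q : Ideal (MvPolynomial (Fin 2) K)} [Q.IsPrime] (hIQ : I ≤ Q)
    (hQ : Q ≤ RingHom.ker (MvPolynomial.constantCoeff (R := K) (σ := Fin 2))) :
    RingHom.ker (MvPolynomial.constantCoeff (R := K) (σ := Fin 2)) ≤ Q := by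
  let φ : MvPolynomial (Fin 2) K ⧸ I →+* K := Ideal.Quotient.lift I MvPolynomial.constantCoeff hI
  have hφ : Function.Surjective φ := fun c =>
    ⟨Ideal.Quotient.mk I (MvPolynomial.C c),
      (Ideal.Quotient.lift_mk _ _ _).trans (MvPolynomial.constantCoeff_C _ _)⟩
  let p := RingHom.ker φ
  have : p.IsMaximal := RingHom.ker_isMaximal_of_surjective φ hφ
  let A := Localization.AtPrime p
  let f := algebraMap (MvPolynomial (Fin 2) K ⧸ I) A
  obtain ⟨-, rs, hrs, hlen⟩ := hCM.2 p
  have hzA : f (Ideal.Quotient.mk I z) ≠ 0 := by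
    intro h0
    obtain ⟨⟨s, hs⟩, hsz⟩ := (IsLocalization.map_eq_zero_iff p.primeCompl A _).1 h0
    obtain ⟨s, rfl⟩ := Ideal.Quotient.mk_surjective s
    have hs' : MvPolynomial.constantCoeff s ≠ 0 := hs
    rw [← map_mul, Ideal.Quotient.eq_zero_iff_mem] at hsz
    have h1 := hzI (s - MvPolynomial.C (MvPolynomial.constantCoeff s)) (by simp)
    have h2 : MvPolynomial.C (MvPolynomial.constantCoeff s) * z ∈ I := by
      convert I.sub_mem hsz h1 using 1
      ring
    exact hz ((Ideal.unit_mul_mem_iff_mem _ ((isUnit_iff_ne_zero.2 hs').map _)).1 h2)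
  have hnil : rs = [] := by
    rcases rs with _ | ⟨r, rs⟩
    · rfl
    exfalso
    have hreg : IsSMulRegular A r :=
      ((RingTheory.Sequence.isWeaklyRegular_cons_iff A r rs).1 hrs.toIsWeaklyRegular).1
    have hr : r ∈ IsLocalRing.maximalIdeal A := by
      rw [IsLocalRing.mem_maximalIdeal, mem_nonunits_iff]
      intro hu
      apply hrs.top_ne_smul
      rw [Ideal.ofList_cons, Ideal.span_singleton_eq_top.2 hu, top_sup_eq, Submodule.top_smul]
    rw [← Localization.AtPrime.map_eq_maximalIdeal] at hr
    have h1 : Ideal.map f p ≤ LinearMap.ker (LinearMap.mulRight A (f (Ideal.Quotient.mk I z))) := by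
      rw [Ideal.map_le_iff_le_comap]
      intro w hw
      obtain ⟨w, rfl⟩ := Ideal.Quotient.mk_surjective w
      change f _ * f _ = 0
      rw [← map_mul, ← map_mul, mul_comm, Ideal.Quotient.eq_zero_iff_mem.2 (hzI w hw), map_zero]
    have h2 : r * f (Ideal.Quotient.mk I z) = 0 := h1 hr
    exact hzA (hreg (by simpa using h2))
  subst hnil
  rw [IsLocalization.AtPrime.ringKrullDim_eq_height p] at hlen
  have hp0 : p.height = 0 := by
    have : ((p.height : ℕ∞) : WithBot ℕ∞) = ((0 : ℕ∞) : WithBot ℕ∞) := by simpa using hlen.symm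
    exact_mod_cast this
  rw [Ideal.height_eq_zero_iff] at hp0
  have hker : RingHom.ker (Ideal.Quotient.mk I) ≤ Q := by rwa [Ideal.mk_ker]
  have hQ' : (Q.map (Ideal.Quotient.mk I)).IsPrime :=
    Ideal.map_isPrime_of_surjective Ideal.Quotient.mk_surjective hker
  have hle : Q.map (Ideal.Quotient.mk I) ≤ p := by
    rw [Ideal.map_le_iff_le_comap]
    exact hQ
  have h1 := hp0.2 ⟨hQ', bot_le⟩ hle
  intro w hw
  have h2 : Ideal.Quotient.mk I w ∈ Q.map (Ideal.Quotient.mk I) := h1 hw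
  have h3 := Ideal.comap_map_of_surjective' (Ideal.Quotient.mk I) Ideal.Quotient.mk_surjective Q
  rw [sup_eq_left.2 hker] at h3
  rw [← h3]
  exact h2

/-- The Cohen-Macaulay property forces a staircase with at least two steps to reach both axes. -/
theorem IsStaircase.ends_eq_zero {a b : ℕ → ℕ} {N : ℕ} (h : IsStaircase a b N) (hN : 1 ≤ N)
    (hCM : IsCohenMacaulay (MvPolynomial (Fin 2) K ⧸ staircaseIdeal K a b N)) :
    a N = 0 ∧ b 0 = 0 := by
  obtain ⟨z, hz, hzI⟩ := exists_socle_staircaseIdeal (K := K) h hN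
  have hI : staircaseIdeal K a b N ≤
      RingHom.ker (MvPolynomial.constantCoeff (R := K) (σ := Fin 2)) := by
    rw [staircaseIdeal, Ideal.span_le]
    rintro _ ⟨i, rfl⟩
    have h1 : biExp (a i) (b i) ≠ 0 := by
      intro h0
      have h1 : a i = 0 := DFunLike.congr_fun h0 0
      have h2 : b i = 0 := DFunLike.congr_fun h0 1
      have h3 := h.fst_lt 0 hN
      have h4 := h.snd_lt 0 hN
      by_cases hi : (i : ℕ) = 0
      · rw [hi] at h1; lia
      · have := h.snd_le (i := 1) (j := i) (by lia) (by lia)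
        lia
    simp [biMon, MvPolynomial.constantCoeff_eq, MvPolynomial.coeff_monomial, h1]
  have key (v w : Fin 2) (hvw : v ≠ w)
      (hv : staircaseIdeal K a b N ≤ Ideal.span {MvPolynomial.X v}) : False := by
    have : (Ideal.span {(MvPolynomial.X v : MvPolynomial (Fin 2) K)}).IsPrime :=
      (Ideal.span_singleton_prime (MvPolynomial.X_ne_zero v)).2 MvPolynomial.X_prime
    have h1 := ker_constantCoeff_le_of_socle hCM hI hz hzI hv (by
      rw [Ideal.span_le, Set.singleton_subset_iff]; simp)
    have h2 : (MvPolynomial.X w : MvPolynomial (Fin 2) K) ∈ Ideal.span {MvPolynomial.X v} :=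
      h1 (by simp)
    rw [Ideal.mem_span_singleton, MvPolynomial.X_dvd_X] at h2
    simp [hvw] at h2
  constructor
  · by_contra ha
    refine key 0 1 (by simp) ?_
    rw [staircaseIdeal, Ideal.span_le]
    rintro _ ⟨i, rfl⟩
    have h1 := h.fst_le (i := i) (j := N) (by lia) le_rfl
    rw [SetLike.mem_coe, Ideal.mem_span_singleton]
    simp only [biMon_eq]
    exact Dvd.dvd.mul_right (dvd_pow_self _ (by lia)) _
  · by_contra hb
    refine key 1 0 (by simp) ?_
    rw [staircaseIdeal, Ideal.span_le]
    rintro _ ⟨i, rfl⟩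
    have h1 := h.snd_le (i := 0) (j := i) (by lia) (by lia)
    rw [SetLike.mem_coe, Ideal.mem_span_singleton]
    simp only [biMon_eq]
    exact Dvd.dvd.mul_left (dvd_pow_self _ (by lia)) _

theorem Ideal.height_eq_two_of_pow_mem {I : Ideal (MvPolynomial (Fin 2) K)} (hI : I ≠ ⊤)
    {c d : ℕ} (hx : MvPolynomial.X 0 ^ c ∈ I) (hy : MvPolynomial.X 1 ^ d ∈ I) : I.height = 2 := by
  apply le_antisymm
  · have h1 := Ideal.height_le_ringKrullDim_of_ne_top hI
    rw [MvPolynomial.ringKrullDim_of_isNoetherianRing, ringKrullDim_eq_zero_of_field] at h1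
    simp only [Nat.card_eq_fintype_card, Fintype.card_fin, zero_add] at h1
    exact WithBot.coe_le_coe.1 h1
  · rw [Ideal.height_eq_inf_minimalPrimes]
    refine le_iInf₂ fun P hP => ?_
    have hPp := hP.1.1
    have hx' : (MvPolynomial.X 0 : MvPolynomial (Fin 2) K) ∈ P := hPp.mem_of_pow_mem _ (hP.1.2 hx)
    have hy' : (MvPolynomial.X 1 : MvPolynomial (Fin 2) K) ∈ P := hPp.mem_of_pow_mem _ (hP.1.2 hy)
    let Q := Ideal.span {(MvPolynomial.X 0 : MvPolynomial (Fin 2) K)}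
    have : Q.IsPrime :=
      (Ideal.span_singleton_prime (MvPolynomial.X_ne_zero 0)).2 MvPolynomial.X_prime
    have h1 : (⊥ : Ideal (MvPolynomial (Fin 2) K)) < Q := by
      rw [bot_lt_iff_ne_bot, Ne, Ideal.span_singleton_eq_bot]
      exact MvPolynomial.X_ne_zero 0
    have h2 : Q < P := by
      refine lt_of_le_of_ne ((Ideal.span_singleton_le_iff_mem _).2 hx') fun h => ?_
      rw [← h, Ideal.mem_span_singleton, MvPolynomial.X_dvd_X] at hy'
      simp at hy'
    have h3 := Ideal.height_add_one_le_of_lt_of_isPrime h1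
    have h4 := Ideal.height_add_one_le_of_lt_of_isPrime h2
    rw [Ideal.height_bot, zero_add] at h3
    calc (2 : ℕ∞) = 1 + 1 := by norm_num
      _ ≤ Q.height + 1 := by gcongr
      _ ≤ P.height := h4

end MonomialIdeals

/-! ### Comparison of free resolutions -/

section Comparison

variable {S : Type*} [CommRing S]

theorem exists_matrix_lift {m p M : Type*} [Fintype m] [DecidableEq m] [Fintype p] [DecidableEq p]
    [AddCommGroup M] [Module S M] {ε : (m → S) →ₗ[S] M} (hε : Function.Surjective ε)
    (f : (p → S) →ₗ[S] M) : ∃ A : Matrix m p S, ∀ v, ε (A.mulVec v) = f v := by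
  obtain ⟨g, hg⟩ := Module.projective_lifting_property ε f hε
  exact ⟨LinearMap.toMatrix' g, fun v => by rw [LinearMap.toMatrix'_mulVec, ← hg]; rfl⟩

theorem exists_matrix_factor {m n p M : Type*} [Fintype n] [Fintype p] [DecidableEq p]
    [AddCommGroup M] [Module S M] {X : Matrix m n S} {ε : (m → S) →ₗ[S] M}
    (hX : Function.Exact X.mulVecLin ε) (C : Matrix m p S) (hC : ∀ v, ε (C.mulVec v) = 0) :
    ∃ B : Matrix n p S, X * B = C := by
  choose B hB using fun j => (hX _).1 (hC (Pi.single j 1))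
  refine ⟨Matrix.of fun i j => B j i, ?_⟩
  ext i j
  have := congrFun (hB j) i
  rw [Matrix.mulVec_single_one] at this
  exact this

/-- Two free presentations of the same module are compared by lifting the identity both ways; the
composite is homotopic to the identity. -/
theorem exists_mul_mul_eq_mul_one_add {m n m' n' M : Type*} [Fintype m] [Fintype n] [Fintype m']
    [Fintype n'] [DecidableEq m] [DecidableEq m'] [DecidableEq n'] [AddCommGroup M]
    [Module S M] {X : Matrix m n S} {ε : (m → S) →ₗ[S] M} (hε : Function.Surjective ε)
    (hX : Function.Exact X.mulVecLin ε) {X' : Matrix m' n' S} {ε' : (m' → S) →ₗ[S] M}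
    (hε' : Function.Surjective ε') (hX' : Function.Exact X'.mulVecLin ε') :
    ∃ (A : Matrix m' m S) (B : Matrix n n' S) (H : Matrix n' m' S),
      A * X * B = X' * (1 + H * X') := by
  obtain ⟨A, hA⟩ := exists_matrix_lift hε' ε
  obtain ⟨A', hA'⟩ := exists_matrix_lift hε ε'
  obtain ⟨B, hB⟩ := exists_matrix_factor hX (A' * X') fun v => by
    rw [← Matrix.mulVec_mulVec, hA']
    exact hX'.apply_apply_eq_zero v
  obtain ⟨H, hH⟩ := exists_matrix_factor hX' (A * A' - 1) fun v => by
    rw [Matrix.sub_mulVec, ← Matrix.mulVec_mulVec, map_sub, hA, hA', Matrix.one_mulVec, sub_self]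
  refine ⟨A, B, H, ?_⟩
  rw [Matrix.mul_assoc, hB, ← Matrix.mul_assoc, Matrix.mul_add, Matrix.mul_one, ← Matrix.mul_assoc,
    hH, Matrix.sub_mul, Matrix.one_mul]
  abel

theorem det_pow_mul_mem_minorsIdeal {m n m' n' : Type*} [Fintype m] [Fintype n] [Fintype m']
    [Fintype n'] [DecidableEq n'] {X : Matrix m n S} {X' : Matrix m' n' S} {A : Matrix m' m S}
    {B : Matrix n n' S} {G : Matrix n' n' S} (h : A * X * B = X' * G) {j : ℤ} {d : S}
    (hd : d ∈ minorsIdeal X' j) : G.det ^ j.toNat * d ∈ minorsIdeal X j := by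
  have h1 : A * X * (B * G.adjugate) = G.det • X' := by
    rw [← Matrix.mul_assoc, h, Matrix.mul_assoc, Matrix.mul_adjugate, Matrix.mul_smul,
      Matrix.mul_one]
  refine minorsIdeal_mul_mul_le A X (B * G.adjugate) j ?_
  rw [h1]
  exact pow_mul_mem_minorsIdeal_smul X' _ j hd

/-- Multiplication by an element `s` of `I` is null-homotopic on the resolution of `S / I`, so `s ^ n`
lies in the ideal of maximal minors. -/
theorem pow_mem_minorsIdeal {m : Type*} [Fintype m] [DecidableEq m] {n : ℕ} {I : Ideal S}
    {X : Matrix m (Fin n) S} (hinj : Function.Injective X.mulVecLin) {ε : (m → S) →ₗ[S] I}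
    (hε : Function.Surjective ε) (hX : Function.Exact X.mulVecLin ε) {s : S} (hs : s ∈ I) :
    s ^ n ∈ minorsIdeal X n := by
  obtain ⟨w, hw⟩ := hε ⟨s, hs⟩
  -- The homotopy in degree one is `τ`, with `X * τ = D`.
  let D : (m → S) →ₗ[S] (m → S) :=
    s • LinearMap.id - (Submodule.subtype I ∘ₗ ε).smulRight w
  have hD (v : m → S) : (LinearMap.toMatrix' D).mulVec v = s • v - (ε v : S) • w := by
    rw [LinearMap.toMatrix'_mulVec]; rfl
  obtain ⟨τ, hτ⟩ := exists_matrix_factor hX (LinearMap.toMatrix' D) fun v => by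
    rw [hD, map_sub, map_smul, map_smul, hw]
    apply Subtype.ext
    change s * (ε v : S) - (ε v : S) * s = 0
    ring
  have h1 : τ * X = s • (1 : Matrix (Fin n) (Fin n) S) := by
    apply Matrix.toLin'.injective
    refine LinearMap.ext fun v => hinj ?_
    rw [Matrix.toLin'_apply, Matrix.toLin'_apply, Matrix.mulVecLin_apply, Matrix.mulVecLin_apply,
      Matrix.smul_mulVec, Matrix.one_mulVec, ← Matrix.mulVec_mulVec, Matrix.mulVec_mulVec, hτ, hD,
      Matrix.mulVec_smul]
    have : ε (X.mulVec v) = 0 := hX.apply_apply_eq_zero v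
    simp [this]
  have h2 := Matrix.det_mul_mul_mem_minorsIdeal τ X 1 (j := n) (by simp)
  rwa [Matrix.mul_one, h1, Matrix.det_smul, Matrix.det_one, mul_one, Fintype.card_fin] at h2

/-- Cramer's rule: a maximal minor multiplies `I` into the principal ideal of the generator
belonging to the deleted row. -/
theorem exists_det_submatrix_mul_eq {n : ℕ} {I : Ideal S} {X : Matrix (Fin (n + 1)) (Fin n) S}
    {ε : (Fin (n + 1) → S) →ₗ[S] I} (hε : Function.Surjective ε)
    (hX : Function.Exact X.mulVecLin ε) (r : Fin n → Fin (n + 1)) (hr : Function.Injective r) :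
    ∃ e ∈ I, ∀ f ∈ I, e ∣ (X.submatrix r id).det * f := by
  obtain ⟨i₀, hi₀⟩ : ∃ i, i ∉ Set.range r := by
    by_contra! h
    have := Fintype.card_le_of_surjective r h
    simp at this
  have hrange (i : Fin (n + 1)) (hi : i ≠ i₀) : ∃ l, r l = i := by
    have h1 : Function.Injective (Fin.cons i₀ r : Fin (n + 1) → Fin (n + 1)) :=
      Fin.cons_injective_iff.2 ⟨hi₀, hr⟩
    obtain ⟨l, hl⟩ := Finite.injective_iff_surjective.1 h1 i
    refine Fin.cases (fun hl => ?_) (fun l hl => ?_) l hl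
    · exact absurd hl.symm hi
    · exact ⟨l, hl⟩
  refine ⟨ε (Pi.single i₀ 1), (ε _).2, fun f hf => ?_⟩
  obtain ⟨v, hv⟩ := hε ⟨f, hf⟩
  let X' := X.submatrix r id
  let g := X'.det • v - X.mulVec (X'.adjugate.mulVec (v ∘ r))
  have hg : g = g i₀ • Pi.single i₀ (1 : S) := by
    ext i
    by_cases hi : i = i₀
    · subst hi; simp
    · obtain ⟨l, rfl⟩ := hrange i hi
      have h1 : X.mulVec (X'.adjugate.mulVec (v ∘ r)) (r l) =
          X'.mulVec (X'.adjugate.mulVec (v ∘ r)) l := rfl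
      have h2 : g (r l) = X'.det * v (r l) - X.mulVec (X'.adjugate.mulVec (v ∘ r)) (r l) := rfl
      rw [h2, h1, Matrix.mulVec_mulVec, Matrix.mul_adjugate, Matrix.smul_mulVec, Matrix.one_mulVec]
      simp [hi]
  have h1 : ε g = X'.det • ε v := by
    have : ε (X.mulVec (X'.adjugate.mulVec (v ∘ r))) = 0 := hX.apply_apply_eq_zero _
    rw [map_sub, map_smul, this, sub_zero]
  rw [hg, map_smul, hv] at h1
  have h2 := congrArg Subtype.val h1
  exact ⟨g i₀, h2.symm.trans (mul_comm _ _)⟩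

end Comparison

section BivariateIdeals

variable {K : Type*} [Field K]

/-- As powers of `x` and `y` are coprime, an element that multiplies both into `(e)` lies in `(e)`.
-/
theorem dvd_of_dvd_mul_pow_of_dvd_mul_pow {δ e : MvPolynomial (Fin 2) K} {c d : ℕ}
    (hx : e ∣ δ * MvPolynomial.X 0 ^ c) (hy : e ∣ δ * MvPolynomial.X 1 ^ d) : e ∣ δ := by
  by_cases he : e = 0
  · subst he
    rw [zero_dvd_iff] at hx ⊢
    exact (mul_eq_zero.1 hx).resolve_right (pow_ne_zero _ (MvPolynomial.X_ne_zero _))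
  obtain ⟨p, hp⟩ := hx
  obtain ⟨q, hq⟩ := hy
  have h1 : MvPolynomial.X 1 ^ d * p = MvPolynomial.X 0 ^ c * q := by
    apply mul_left_cancel₀ he
    linear_combination (MvPolynomial.X 0 ^ c : MvPolynomial (Fin 2) K) * hq -
      (MvPolynomial.X 1 ^ d : MvPolynomial (Fin 2) K) * hp
  have hX : Prime (MvPolynomial.X 0 : MvPolynomial (Fin 2) K) := MvPolynomial.X_prime
  have h2 : (MvPolynomial.X 0 : MvPolynomial (Fin 2) K) ^ c ∣ p := by
    refine hX.pow_dvd_of_dvd_mul_left c (fun hd => ?_) ⟨q, h1⟩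
    have h3 := hX.dvd_of_dvd_pow hd
    rw [MvPolynomial.X_dvd_X] at h3
    simp at h3
  obtain ⟨h, rfl⟩ := h2
  refine ⟨h, mul_right_cancel₀ (pow_ne_zero c hX.ne_zero) ?_⟩
  rw [hp]
  ring

/-- A polynomial with constant term one is a unit modulo an ideal containing powers of both
variables. -/
theorem mem_of_pow_mul_mem {J : Ideal (MvPolynomial (Fin 2) K)} {c d : ℕ}
    (hx : MvPolynomial.X 0 ^ c ∈ J) (hy : MvPolynomial.X 1 ^ d ∈ J) {u p : MvPolynomial (Fin 2) K}
    (hu : MvPolynomial.constantCoeff u = 1) {k : ℕ} (h : u ^ k * p ∈ J) : p ∈ J := by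
  have h1 : 1 - u ∈ J.radical := by
    have h2 : 1 - u ∈ Ideal.span (MvPolynomial.X '' (Set.univ : Set (Fin 2))) := by
      rw [MvPolynomial.mem_ideal_span_X_image]
      intro m hm
      have hm0 : m ≠ 0 := by
        rintro rfl
        rw [MvPolynomial.mem_support_iff] at hm
        apply hm
        rw [← MvPolynomial.constantCoeff_eq, map_sub, map_one, hu, sub_self]
      obtain ⟨i, hi⟩ := Finsupp.ne_iff.1 hm0
      exact ⟨i, trivial, hi⟩
    refine (Ideal.span_le.2 ?_) h2
    rintro _ ⟨i, -, rfl⟩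
    fin_cases i
    exacts [⟨c, hx⟩, ⟨d, hy⟩]
  have h3 : IsUnit (Ideal.Quotient.mk J u) := by
    have : IsNilpotent (Ideal.Quotient.mk J (1 - u)) := by
      obtain ⟨n, hn⟩ := h1
      exact ⟨n, by rw [← map_pow, Ideal.Quotient.eq_zero_iff_mem]; exact hn⟩
    have := this.isUnit_one_sub
    rwa [map_sub, map_one, sub_sub_cancel] at this
  rw [← Ideal.Quotient.eq_zero_iff_mem, map_mul, map_pow] at h
  rw [← Ideal.Quotient.eq_zero_iff_mem]
  exact ((h3.pow k).mul_right_eq_zero).1 h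

theorem constantCoeff_det_one_add_mul_staircaseMatrix {a b : ℕ → ℕ} {N : ℕ}
    (h : IsStaircase a b N) (H : Matrix (Fin N) (Fin (N + 1)) (MvPolynomial (Fin 2) K)) :
    MvPolynomial.constantCoeff (1 + H * staircaseMatrix K a b N).det = 1 := by
  have h0 : (staircaseMatrix K a b N).map MvPolynomial.constantCoeff = 0 := by
    ext i j
    have h1 := h.fst_lt j j.2
    have h2 := h.snd_lt j j.2
    have h3 (s t : ℕ) (hst : 0 < s ∨ 0 < t) :
        MvPolynomial.constantCoeff (biMon K s t) = 0 := by
      rw [biMon_eq, map_mul, map_pow, map_pow, MvPolynomial.constantCoeff_X,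
        MvPolynomial.constantCoeff_X]
      rcases hst with hs | ht
      · rw [zero_pow hs.ne', zero_mul]
      · rw [zero_pow ht.ne', mul_zero]
    have h4 := h3 0 (b (j + 1) - b j) (by lia)
    have h5 := h3 (a j - a (j + 1)) 0 (by lia)
    simp only [staircaseMatrix, Matrix.map_apply, Matrix.of_apply, map_sub, Matrix.zero_apply]
    split_ifs <;> simp [h4, h5]
  rw [RingHom.map_det, RingHom.mapMatrix_apply, Matrix.map_add _ (map_add _), Matrix.map_mul, h0,
    Matrix.mul_zero, add_zero, Matrix.map_one _ (map_zero _) (map_one _), Matrix.det_one]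

theorem spanFinrank_staircaseIdeal_le (a b : ℕ → ℕ) (N : ℕ) :
    Submodule.spanFinrank (staircaseIdeal K a b N) ≤ N + 1 := by
  refine (Submodule.spanFinrank_span_le_ncard_of_finite (Set.finite_range _)).trans ?_
  rw [← Set.image_univ]
  refine (Set.ncard_image_le Set.finite_univ).trans ?_
  simp [Set.ncard_univ]

end BivariateIdeals

/-! ### Hilbert-Burch matrices of staircase ideals -/

section HilbertBurch

variable {K : Type u} [Field K]

theorem X_pow_mem_staircaseIdeal {a b : ℕ → ℕ} {N : ℕ} (ha : a N = 0) (hb : b 0 = 0) :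
    MvPolynomial.X 0 ^ a 0 ∈ staircaseIdeal K a b N ∧
      MvPolynomial.X 1 ^ b N ∈ staircaseIdeal K a b N := by
  have h1 := biMon_mem_staircaseIdeal (K := K) (a := a) (b := b) (Nat.zero_le N) le_rfl hb.le
  have h2 := biMon_mem_staircaseIdeal (K := K) (a := a) (b := b) (le_refl N) ha.le le_rfl
  rw [biMon_eq, pow_zero, mul_one] at h1
  rw [biMon_eq, pow_zero, one_mul] at h2
  exact ⟨h1, h2⟩

/-- A hypersurface ring is Gorenstein, so its canonical module has trace the unit ideal. If `f` is a
unit, this holds because the quotient is the zero ring. -/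
theorem traceIdeal_canonicalModule_span_singleton {S : Type u} [CommRing S] [IsDomain S]
    [IsNoetherianRing S] {f : S} (hf : f ≠ 0) :
    traceIdeal (S ⧸ Ideal.span {f}) (CanonicalModule (Ideal.span {f})) = ⊤ := by
  by_cases hu : IsUnit f
  · have : Subsingleton (S ⧸ Ideal.span {f}) :=
      Ideal.Quotient.subsingleton_iff.2 (Ideal.span_singleton_eq_top.2 hu)
    exact Subsingleton.elim _ _
  · have hreg := mem_nonZeroDivisors_of_ne_zero hf
    rw [traceIdeal_eq_map_kernelCoordIdeal (isCokernelTranspose_canonicalModule_of_height_eq_one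
      hreg (Ideal.height_span_singleton_eq_one_of_mem_nonZeroDivisors hreg hu))]
    have h1 : kernelCoordIdeal (Ideal.span {f}) (Matrix.of fun _ _ : Unit => f) = ⊤ := by
      rw [Ideal.eq_top_iff_one]
      refine mem_kernelCoordIdeal (v := fun _ => 1) (fun i => ?_) ()
      simp [Matrix.mulVec, dotProduct]
    rw [h1, Ideal.map_top]

/-- The minors of an arbitrary resolution of a staircase ideal: there are as many columns as in the
staircase matrix, the maximal minors lie in the ideal, and the submaximal minors of the staircase
matrix are combinations of those of `X`. -/
theorem minorsIdeal_of_staircaseIdeal {a b : ℕ → ℕ} {N : ℕ} (h : IsStaircase a b N)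
    (ha : a N = 0) (hb : b 0 = 0) {n : ℕ} (hn : n ≤ N)
    {X : Matrix (Fin (n + 1)) (Fin n) (MvPolynomial (Fin 2) K)}
    (hinj : Function.Injective X.mulVecLin)
    {ε : (Fin (n + 1) → MvPolynomial (Fin 2) K) →ₗ[MvPolynomial (Fin 2) K] staircaseIdeal K a b N}
    (hε : Function.Surjective ε) (hX : Function.Exact X.mulVecLin ε) :
    n = N ∧ (∀ r : Fin n → Fin (n + 1), (X.submatrix r id).det ∈ staircaseIdeal K a b N) ∧
      minorsIdeal (staircaseMatrix K a b N) (N - 1) ≤ minorsIdeal X (n - 1) := by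
  obtain ⟨hx, hy⟩ := X_pow_mem_staircaseIdeal (K := K) (N := N) ha hb
  obtain ⟨A, B, H, hABH⟩ := exists_mul_mul_eq_mul_one_add hε hX
    (staircaseMap_surjective (K := K) a b N) (staircase_exact h)
  let G := 1 + H * staircaseMatrix K a b N
  have hG : MvPolynomial.constantCoeff G.det = 1 :=
    constantCoeff_det_one_add_mul_staircaseMatrix h H
  have hnN : n = N := by
    refine le_antisymm hn ?_
    have hGinj : Function.Injective G.mulVec := by
      apply Matrix.mulVec_injective_of_det_ne_zero
      intro h0
      rw [h0, map_zero] at hG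
      exact zero_ne_one hG
    have hBinj : Function.Injective B.mulVecLin := by
      intro v w hvw
      rw [Matrix.mulVecLin_apply, Matrix.mulVecLin_apply] at hvw
      apply hGinj
      apply staircaseMatrix_injective a b N
      rw [Matrix.mulVecLin_apply, Matrix.mulVecLin_apply, Matrix.mulVec_mulVec,
        Matrix.mulVec_mulVec, ← hABH, ← Matrix.mulVec_mulVec, hvw, Matrix.mulVec_mulVec]
    simpa using card_le_of_injective (MvPolynomial (Fin 2) K) B.mulVecLin hBinj
  refine ⟨hnN, fun r => ?_, fun p hp => ?_⟩
  · by_cases hr : Function.Injective r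
    · obtain ⟨e, he, hdvd⟩ := exists_det_submatrix_mul_eq hε hX r hr
      exact Ideal.mem_of_dvd _ (dvd_of_dvd_mul_pow_of_dvd_mul_pow (hdvd _ hx) (hdvd _ hy)) he
    · obtain ⟨i, j, hij, hne⟩ : ∃ i j, r i = r j ∧ i ≠ j := by
        simpa [Function.Injective] using hr
      rw [Matrix.det_zero_of_row_eq hne (by ext k; simp [hij])]
      exact Ideal.zero_mem _
  · have hx' := minorsIdeal_le_pred X n (pow_mem_minorsIdeal hinj hε hX hx)
    have hy' := minorsIdeal_le_pred X n (pow_mem_minorsIdeal hinj hε hX hy)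
    rw [← pow_mul] at hx' hy'
    have hp' := det_pow_mul_mem_minorsIdeal hABH hp
    rw [show (n : ℤ) - 1 = N - 1 by rw [hnN]] at hx' hy' ⊢
    exact mem_of_pow_mul_mem hx' hy' hG hp'

end HilbertBurch

theorem theorem3p1 {K : Type u} [Field K] (I : Ideal (MvPolynomial (Fin 2) K))
    (hI : IsMonomialIdeal I)
    (hCM : IsCohenMacaulay (MvPolynomial (Fin 2) K ⧸ I))
    {n : ℕ} (X : Matrix (Fin (n + 1)) (Fin n) (MvPolynomial (Fin 2) K))
    (hX : IsHilbertBurchMatrix I X) :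
    I ≤ minorsIdeal X ((Submodule.spanFinrank I : ℤ) - 2) ∧
      traceIdeal (MvPolynomial (Fin 2) K ⧸ I) (CanonicalModule I) =
        (minorsIdeal X ((Submodule.spanFinrank I : ℤ) - 2)).map (Ideal.Quotient.mk I) := by
  have h0 : I ≠ ⊥ := by
    rintro rfl
    have := hX.minimal
    rw [Submodule.spanFinrank_bot] at this
    lia
  obtain ⟨a, b, N, h, rfl⟩ := exists_eq_staircaseIdeal hI h0
  have hmin := hX.minimal
  have hn : n ≤ N := by
    have := spanFinrank_staircaseIdeal_le (K := K) a b N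
    lia
  rw [hmin, show ((n + 1 : ℕ) : ℤ) - 2 = n - 1 by push_cast; ring]
  rcases Nat.eq_zero_or_pos N with rfl | hN
  · -- For a principal ideal the minors have size at most zero, and both sides are the unit ideal.
    have htop : minorsIdeal X ((n : ℤ) - 1) = ⊤ := if_pos (by lia)
    rw [htop, Ideal.map_top]
    refine ⟨le_top, ?_⟩
    have hspan : staircaseIdeal K a b 0 = Ideal.span {biMon K (a 0) (b 0)} := by
      rw [staircaseIdeal]
      congr 1
      ext p
      simp
    rw [hspan]
    exact traceIdeal_canonicalModule_span_singleton (biMon_ne_zero _ _)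
  · obtain ⟨ha, hb⟩ := h.ends_eq_zero hN hCM
    obtain ⟨ε, hε, hXε⟩ := hX.exact
    obtain ⟨rfl, hmax, hle⟩ := minorsIdeal_of_staircaseIdeal h ha hb hn hX.injective hε hXε
    have hne : staircaseIdeal K a b n ≠ ⊤ := by
      obtain ⟨z, hz, -⟩ := exists_socle_staircaseIdeal (K := K) h hN
      rintro htop
      exact hz (htop ▸ trivial)
    obtain ⟨hx, hy⟩ := X_pow_mem_staircaseIdeal (K := K) (N := n) ha hb
    have hht := Ideal.height_eq_two_of_pow_mem hne hx hy
    have : Nonempty (Fin n) := ⟨⟨0, hN⟩⟩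
    refine ⟨(le_kernelCoordIdeal _ _).trans
      ((kernelCoordIdeal_staircaseMatrix_le h ha hb).trans hle), le_antisymm ?_ ?_⟩
    · rw [traceIdeal_eq_map_kernelCoordIdeal (isCokernelTranspose_canonicalModule_of_height_eq_two
        hht (staircaseMatrix_injective a b n) (staircaseMap_surjective a b n) (staircase_exact h))]
      exact Ideal.map_mono ((kernelCoordIdeal_staircaseMatrix_le h ha hb).trans hle)
    · rw [traceIdeal_eq_map_kernelCoordIdeal (isCokernelTranspose_canonicalModule_of_height_eq_two
        hht hX.injective hε hXε)]
      obtain ⟨k, rfl⟩ : ∃ k, n = k + 1 := ⟨n - 1, by lia⟩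
      rw [show (((k + 1 : ℕ) : ℤ) - 1) = k by push_cast; ring]
      exact Ideal.map_mono (minorsIdeal_le_kernelCoordIdeal X hmax)
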